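/- **Setting.** Let $X$ be a set of $n$ boolean variables and $\mathbb F=\mathbb F_p$ with $p$ a prime, $p>2^n$. GBC-expressions are $\varphi ::= \top\mid\bot\mid x\mid\neg\varphi\mid\varphi\circledast\psi\mid\pi_{[x:=b]}\varphi\mid\varphi[y/x]$, with $\circledast$ any binary boolean operator, $b\in\{0,1\}$, and $y$ not free in $\varphi$ (the free variables of $\pi_{[x:=b]}\varphi$ are those of $\varphi$ without $x$; those of $\varphi[y/x]$ are those of $\varphi$ with $y$ in place of $x$). A circuit $\varphi$ is a finite set of GBC-expressions (gates) closed under subexpressions, with $|\varphi|$ elements. Each gate $\psi$ has a boolean function $\mathrm{fn}(\psi)$, and an arithmetization $[\![\psi]\!]\in\mathbb F[X]$ with $[\![\neg\psi]\!]=1-[\![\psi]\!]$, $[\![\psi_1\circledast\psi_2]\!]$ the bilinear extension of $\circledast$ applied to $[\![\psi_1]\!],[\![\psi_2]\!]$, and substitution for $\pi$ and renaming. In $\mathrm{conv}(\varphi)$ each binary gate is followed by degree-reduction gates $\delta_x$ for all its free variables $x$ ($\delta_x$ replaces every positive exponent of $x$ by $1$). Claims about gates of $\mathrm{conv}(\varphi)$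 (those that correspond to the gates of $\varphi$) are: $[\![\psi]\!](\sigma)=k$ ($\mathbb F$-evaluation, $\sigma\in\mathbb F^X$); $\mathrm{fn}(\psi)(\tau)=b$ ($\tau\in\{0,1\}^X$); "$\mathrm{fn}(\psi)$ has exactly $k$ satisfying assignments of its free variables" ($0\le k<p$); $\mathrm{fn}(\psi_1)=\mathrm{fn}(\psi_2)$; $\mathrm{fn}(\psi_1)\ne\mathrm{fn}(\psi_2)$. **Protocol.** The gates of $\varphi$ are partitioned into $\varphi_0,\dots,\varphi_i$, such that the successors (immediate subexpressions) of a gate of $\varphi_j$ lie in $\varphi_0\cup\dots\cup\varphi_j$; the claims are partitioned into $\mathcal C_0,\dots,\mathcal C_i$, where $\mathcal C_j$ is about gates in $\varphi_0\cup\dots\cup\varphi_j$. Verifier picks one $\sigma_R\in\mathbb F^X$ uniformly at random and then performs invocations $j=0,\dots,i$. A query to Prover is a gate $\psi$ and an assignment of its free variables (answer: an element of $\mathbb F$), or one that leaves out one variable $x$ (answer: a polynomial in $x$; Verifier rejects if its degree exceeds $2$), or a pair of gates (answer: an assignment at which they differ). In invocation $j$: 1. *Normalize.* Each claim in $\mathcal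 C_j$ is replaced by $\mathbb F$-evaluation claims: $\mathrm{fn}(\psi)(\tau)=b$ by $[\![\psi]\!](\tau)=b$; a count claim by $[\![\psi]\!](\tfrac12,\dots,\tfrac12)=k\,2^{-f}$, with $f$ the number of free variables of $\psi$; for an equivalence claim Verifier asks for $k_1,k_2$, the values of $[\![\psi_1]\!],[\![\psi_2]\!]$ at $\sigma_R$, rejects if $k_1\ne k_2$, and adds the claims $[\![\psi_1]\!](\sigma_R)=k_1$, $[\![\psi_2]\!](\sigma_R)=k_2$; for an inequivalence claim it does the same at an assignment $\sigma$ supplied by Prover, and rejects if $k_1=k_2$. 2. For each gate $\psi\in\varphi_j$ Verifier asks for the value $k_\psi$ of $[\![\psi]\!]$ at $\sigma_R$ and adds the claim $[\![\psi]\!](\sigma_R)=k_\psi$. 3. The gates of $\mathrm{conv}(\varphi_j)$ are visited in topological order, from outputs to inputs. *Merge:* for each free variable $x$ of the gate $\psi$ in turn, and for each claim $[\![\psi]\!](\sigma)=k$, Verifier asks for $q(x)=[\![\psi]\!](\sigma\setminus x)$, rejects if $q(\sigma(x))\ne k$, and replaces the claim by $[\![\psi]\!](\sigma[x\mapsto\sigma_R(x)])=q(\sigma_R(x))$;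 unless a single claim is left in the end (assignments being compared on the free variables of $\psi$), Verifier rejects. *Propagate* the claim $[\![\psi]\!](\sigma)=k$: if $\psi$ is $\top$, $\bot$ or a variable, reject unless it is true; if $\psi=\psi_1\circledast\psi_2$ (or $\neg\psi_1$), ask for the values $k_1,k_2$ of the successors at $\sigma$, reject unless they yield $k$, and add these two claims (one claim); if $\psi=\delta_x\psi'$, ask for $q(x)=[\![\psi']\!](\sigma\setminus x)$, reject unless $\sigma(x)q(1)+(1-\sigma(x))q(0)=k$, and add $[\![\psi']\!](\sigma[x\mapsto\sigma_R(x)])=q(\sigma_R(x))$; if $\psi=\pi_{[x:=b]}\psi'$, add $[\![\psi']\!](\sigma[x\mapsto b])=k$; if $\psi=\psi'[y/x]$, add $[\![\psi']\!](\sigma[x\mapsto\sigma(y)])=k$. 4. The claims about each gate $\psi$ of an earlier invocation, now an $\varepsilon$-node without successors, are merged (if there are any) into $[\![\psi]\!](\sigma')=k'$; Verifier rejects unless $\sigma'=\sigma_R$ on the free variables of $\psi$ and $k'=k_\psi$. Then the gates of $\varphi_j$ become $\varepsilon$-nodes. Verifier accepts if it does not reject in any invocation. A Prover acts as an *oracle*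 if each answer is a function of the current query alone. The honest Prover answers all queries truthfully. **Lemma.** All probabilities are over $\sigma_R$. (Soundness) If some claim in $\mathcal C_0\cup\dots\cup\mathcal C_i$ is false then, for every Prover that acts as an oracle, Verifier accepts with probability at most $(4n|\varphi|+n)/|\mathbb F|$. Moreover, for each $j\le i$, invocations $0,\dots,j$ all accept with probability at most $\bigl(4n\sum_{c\le j}|\varphi_c|\bigr)/|\mathbb F|$ if $\mathcal C_j$ contains a false $\mathbb F$-evaluation claim, and at most $\bigl(4n\sum_{c\le j}|\varphi_c|+n\bigr)/|\mathbb F|$ if $\mathcal C_j$ contains any false claim. (Completeness) If all claims are true, then Verifier accepts with probability $1$ for the honest Prover. Moreover, for each $j\le i$, if all claims in $\mathcal C_j$ are true, then with the honest Prover invocation $j$ is the first to reject with probability $0$. -/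

import Mathlib

namespace GBCCert

/-! ### Generalized boolean circuits -/

/-- Expressions over the variables `x_0, …, x_{n-1}`. The constructor `red x` is the degree-reduction
gate `δ_x`; it does not occur in the input circuit and is only introduced by `conv`.
`ren y x a` is `a[y/x]` (substitute `y` for `x`), `proj x b a` is `π_{[x:=b]} a`. -/
inductive Gate (n : ℕ) : Type
  | top : Gate n
  | bot : Gate n
  | var : Fin n → Gate n
  | neg : Gate n → Gate n
  | bin : (Bool → Bool → Bool) → Gate n → Gate n → Gate n
  | proj : Fin n → Bool → Gate n → Gate n
  | ren : Fin n → Fin n → Gate n → Gate n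
  | red : Fin n → Gate n → Gate n
  deriving DecidableEq

namespace Gate

variable {n : ℕ}

/-- The free variables: `π_{[x:=b]}` removes `x`, and `a[y/x]` replaces `x` by `y`. -/
def free : Gate n → Finset (Fin n)
  | top => ∅
  | bot => ∅
  | var x => {x}
  | neg a => a.free
  | bin _ a b => a.free ∪ b.free
  | proj x _ a => a.free.erase x
  | ren y x a => a.free.image (fun z => if z = x then y else z)
  | red _ a => a.free

/-- The free variables in increasing order. -/
def freeList (a : Gate n) : List (Fin n) :=
  (List.finRange n).filter (fun x => x ∈ a.free)

/-- The GBC-expressions: no degree reductions, and `y` does not occur in `a` for each `a[y/x]`. -/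
def IsGBC : Gate n → Prop
  | top => True
  | bot => True
  | var _ => True
  | neg a => a.IsGBC
  | bin _ a b => a.IsGBC ∧ b.IsGBC
  | proj _ _ a => a.IsGBC
  | ren y _ a => a.IsGBC ∧ y ∉ a.free
  | red _ _ => False

/-- Immediate subexpressions. -/
def children : Gate n → List (Gate n)
  | top => []
  | bot => []
  | var _ => []
  | neg a => [a]
  | bin _ a b => [a, b]
  | proj _ _ a => [a]
  | ren _ _ a => [a]
  | red _ a => [a]

/-- The boolean function of a gate. -/
def fn : Gate n → (Fin n → Bool) → Bool
  | top, _ => true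
  | bot, _ => false
  | var x, τ => τ x
  | neg a, τ => !(a.fn τ)
  | bin op a b, τ => op (a.fn τ) (b.fn τ)
  | proj x b a, τ => a.fn (Function.update τ x b)
  | ren y x a, τ => a.fn (Function.update τ x (τ y))
  | red _ a, τ => a.fn τ

/-- The number of satisfying assignments of `fn a`, as a function of its free variables. -/
def satCount (a : Gate n) : ℕ :=
  (Finset.univ.filter (fun τ : Fin n → Bool =>
    (∀ x, x ∉ a.free → τ x = false) ∧ a.fn τ = true)).card

/-- `δ_{x_1} (δ_{x_2} (… a))`. -/
def redChain (xs : List (Fin n)) (a : Gate n) : Gate n :=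
  xs.foldr Gate.red a

/-- The circuit with degree reductions, for all free variables, above each binary gate. -/
def conv : Gate n → Gate n
  | top => top
  | bot => bot
  | var x => var x
  | neg a => neg a.conv
  | bin op a b => redChain (bin op a b).freeList (bin op a.conv b.conv)
  | proj x b a => proj x b a.conv
  | ren y x a => ren y x a.conv
  | red x a => red x a.conv

/-- The gates of `conv g` that stem from the gate `g` itself, from the topmost one, `conv g`,
downwards: for a binary gate the degree reductions followed by the binary gate. -/
def block : Gate n → List (Gate n)
  | bin op a b =>
      (bin op a b).freeList.tails.map (fun t => redChain t (bin op a.conv b.conv))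
  | g => [g.conv]

end Gate

/-! ### Arithmetization -/

section Arithmetization

variable {n : ℕ} {F : Type} [Field F]

/-- A bit as an element of the field. -/
def bit (b : Bool) : F := if b then 1 else 0

/-- The polynomial operation of a binary boolean operator, e.g. `a * b` for the conjunction
and `a + b - a * b` for the disjunction. -/
def opHat {R : Type} [CommRing R] (op : Bool → Bool → Bool) (a b : R) : R :=
  (if op true true then a * b else 0) + (if op true false then a * (1 - b) else 0)
    + (if op false true then (1 - a) * b else 0)
    + (if op false false then (1 - a) * (1 - b) else 0)

/-- Degree reduction: every positive exponent of `x` becomes `1`. -/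
noncomputable def degRed (x : Fin n) (q : MvPolynomial (Fin n) F) : MvPolynomial (Fin n) F :=
  ∑ m ∈ q.support, MvPolynomial.monomial (m.update x (min (m x) 1)) (q.coeff m)

/-- The arithmetization of a gate. -/
noncomputable def arith (F : Type) [Field F] : Gate n → MvPolynomial (Fin n) F
  | .top => 1
  | .bot => 0
  | .var x => MvPolynomial.X x
  | .neg a => 1 - arith F a
  | .bin op a b => opHat op (arith F a) (arith F b)
  | .proj x b a =>
      MvPolynomial.bind₁ (Function.update MvPolynomial.X x (MvPolynomial.C (bit b))) (arith F a)
  | .ren y x a =>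
      MvPolynomial.bind₁ (Function.update MvPolynomial.X x (MvPolynomial.X y)) (arith F a)
  | .red x a => degRed x (arith F a)

/-- The value of the arithmetization of `a` at the point `σ`. -/
noncomputable def val (a : Gate n) (σ : Fin n → F) : F :=
  MvPolynomial.eval σ (arith F a)

end Arithmetization

/-! ### Claims -/

/-- The initial claims; a claim about `g` is a claim about the gate `conv g` of the circuit. -/
inductive Claim (n : ℕ) (F : Type) : Type
  | evalF : Gate n → (Fin n → F) → F → Claim n F
  | evalB : Gate n → (Fin n → Bool) → Bool → Claim n F
  | count : Gate n → ℕ → Claim n F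
  | equiv : Gate n → Gate n → Claim n F
  | nequiv : Gate n → Gate n → Claim n F

namespace Claim

variable {n : ℕ} {F : Type}

/-- The claim is true. -/
def Holds [Field F] : Claim n F → Prop
  | evalF g σ k => val g.conv σ = k
  | evalB g τ b => g.conv.fn τ = b
  | count g k => g.conv.satCount = k
  | equiv g h => g.conv.fn = h.conv.fn
  | nequiv g h => g.conv.fn ≠ h.conv.fn

/-- The claim is an `F`-evaluation (assignment) claim. -/
def IsEvalF : Claim n F → Prop
  | evalF _ _ _ => True
  | _ => False

/-- The claim is about gates in the list `gs`, and the number in a count claim is given as one of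
the integers `0, …, q - 1` (`q` is the order of the prime field). -/
def IsAbout (gs : List (Gate n)) (q : ℕ) : Claim n F → Prop
  | evalF g _ _ => g ∈ gs
  | evalB g _ _ => g ∈ gs
  | count g k => g ∈ gs ∧ k < q
  | equiv g h => g ∈ gs ∧ h ∈ gs
  | nequiv g h => g ∈ gs ∧ h ∈ gs

end Claim

/-! ### Provers -/

/-- The restriction of `σ` to the variables in `S`, as a partial assignment. -/
def restrict {n : ℕ} {F : Type} (S : Finset (Fin n)) (σ : Fin n → F) : Fin n → Option F :=
  fun x => if x ∈ S then some (σ x) else none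

/-- A Prover that acts as an oracle: each answer is a function of the current query alone.
* `value a s` answers the challenge to evaluate the arithmetization of `a` at `s`;
* `poly a s x` answers the challenge to evaluate it at `s`, which leaves `x` unassigned;
* `distinct a b` answers the challenge to give an assignment at which `a` and `b` differ. -/
structure OracleProver (n : ℕ) (F : Type) [Field F] where
  value : Gate n → (Fin n → Option F) → F
  poly : Gate n → (Fin n → Option F) → Fin n → Polynomial F
  distinct : Gate n → Gate n → (Fin n → F)

/-- `d` answers all distinct assignment challenges truthfully. -/
def IsDistinguisher {n : ℕ} {F : Type} [Field F] (d : Gate n → Gate n → (Fin n → F)) : Prop :=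
  ∀ a b : Gate n, (∃ σ : Fin n → F, val a σ ≠ val b σ) → val a (d a b) ≠ val b (d a b)

/-- The honest Prover. It evaluates the arithmetizations and answers distinct assignment challenges
by `d`. (In the queries of the protocol all free variables of the gate are assigned, except for `x`
in the second component.) -/
noncomputable def honestProver {n : ℕ} {F : Type} [Field F]
    (d : Gate n → Gate n → (Fin n → F)) : OracleProver n F where
  value a s := val a (fun y => (s y).getD 0)
  poly a s x := MvPolynomial.aeval
    (fun y => if y = x then Polynomial.X else Polynomial.C ((s y).getD 0)) (arith F a)
  distinct := d

/-! ### The Verifier -/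

/-- The claim that the arithmetization of `gate` (a gate of the circuit with degree reductions)
has value `k` at `σ`. Only the values of `σ` on the free variables of `gate` matter. -/
structure EvalClaim (n : ℕ) (F : Type) where
  gate : Gate n
  σ : Fin n → F
  k : F

/-- An invocation of the protocol: the gates that it checks, in topological order (from outputs to
inputs), and the set of claims. -/
structure Batch (n : ℕ) (F : Type) where
  gates : List (Gate n)
  claims : List (Claim n F)

section Verifier

variable {n : ℕ} {F : Type} [Field F] [DecidableEq F]

/-- The challenge to evaluate `a` at `σ`. -/
def askValue (P : OracleProver n F) (a : Gate n) (σ : Fin n → F) : F :=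
  P.value a (restrict a.free σ)

/-- The challenge to evaluate `a` at `σ` without its value for `x`; answers of degree larger
than two are rejected. -/
noncomputable def askPoly (P : OracleProver n F) (a : Gate n) (σ : Fin n → F) (x : Fin n) :
    Option (Polynomial F) :=
  let q := P.poly a (restrict (a.free.erase x) σ) x
  if q.natDegree ≤ 2 then some q else none

/-- Normalization of a claim into evaluation claims (`none`: Verifier rejects). Here and below,
`ρ` is the random assignment that is used in place of all random choices. -/
def normalize (P : OracleProver n F) (ρ : Fin n → F) : Claim n F → Option (List (EvalClaim n F))
  | .evalF g σ k => some [⟨g.conv, σ, k⟩]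
  | .evalB g τ b => some [⟨g.conv, fun x => bit (τ x), bit b⟩]
  | .count g k => some [⟨g.conv, fun _ => 2⁻¹, (k : F) * 2⁻¹ ^ g.conv.free.card⟩]
  | .equiv g h =>
      let u := askValue P g.conv ρ
      let v := askValue P h.conv ρ
      if u = v then some [⟨g.conv, ρ, u⟩, ⟨h.conv, ρ, v⟩] else none
  | .nequiv g h =>
      let σ := P.distinct g.conv h.conv
      let u := askValue P g.conv σ
      let v := askValue P h.conv σ
      if u = v then none else some [⟨g.conv, σ, u⟩, ⟨h.conv, σ, v⟩]

/-- One step of `merge`, for the variable `x` and a single claim. -/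
noncomputable def mergeClaim (P : OracleProver n F) (ρ : Fin n → F) (x : Fin n)
    (c : EvalClaim n F) : Option (EvalClaim n F) := do
  let q ← askPoly P c.gate c.σ x
  if q.eval (c.σ x) = c.k then
    some ⟨c.gate, Function.update c.σ x (ρ x), q.eval (ρ x)⟩
  else none

/-- Merge the claims in `C`, all about the gate `a`, into a single one. -/
noncomputable def merge (P : OracleProver n F) (ρ : Fin n → F) (a : Gate n)
    (C : List (EvalClaim n F)) : Option (EvalClaim n F) := do
  let D ← a.freeList.foldlM (fun E x => E.mapM (mergeClaim P ρ x)) C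
  match D with
  | [] => none
  | c :: cs =>
      if ∀ c' ∈ cs, restrict a.free c'.σ = restrict a.free c.σ ∧ c'.k = c.k then some c else none

/-- Replace a claim about `a` by claims about its successors; claims about leaves are checked. -/
noncomputable def propagate (P : OracleProver n F) (ρ σ : Fin n → F) (k : F) :
    Gate n → Option (List (EvalClaim n F))
  | .top => if 1 = k then some [] else none
  | .bot => if 0 = k then some [] else none
  | .var x => if σ x = k then some [] else none
  | .neg a =>
      let u := askValue P a σ
      if 1 - u = k then some [⟨a, σ, u⟩] else none
  | .bin op a b =>
      let u := askValue P a σ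
      let v := askValue P b σ
      if opHat op u v = k then some [⟨a, σ, u⟩, ⟨b, σ, v⟩] else none
  | .proj x b a => some [⟨a, Function.update σ x (bit b), k⟩]
  | .ren y x a => some [⟨a, Function.update σ x (σ y), k⟩]
  | .red x a => do
      let q ← askPoly P a σ x
      if σ x * q.eval 1 + (1 - σ x) * q.eval 0 = k then
        some [⟨a, Function.update σ x (ρ x), q.eval (ρ x)⟩]
      else none

/-- The claims in `C` about the gate `a`. -/
def claimsAbout (C : List (EvalClaim n F)) (a : Gate n) : List (EvalClaim n F) :=
  C.filter (fun c => c.gate = a)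

/-- The rounds for the gates in the list, in this order, starting with the claims `C`. The result
is the set of all claims at the end. -/
noncomputable def certify (P : OracleProver n F) (ρ : Fin n → F) :
    List (Gate n) → List (EvalClaim n F) → Option (List (EvalClaim n F))
  | [], C => some C
  | a :: as, C => do
      let c ← merge P ρ a (claimsAbout C a)
      let C' ← propagate P ρ c.σ c.k a
      certify P ρ as (C ++ C')

/-- The check of the claims in `C` about an `ε`-node, which has replaced the gate `e.1` with the
claimed value `e.2` at `ρ`. -/
noncomputable def checkEps (P : OracleProver n F) (ρ : Fin n → F) (C : List (EvalClaim n F))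
    (e : Gate n × F) : Bool :=
  if (claimsAbout C e.1).isEmpty then true
  else match merge P ρ e.1 (claimsAbout C e.1) with
    | none => false
    | some c => decide (restrict e.1.free c.σ = restrict e.1.free ρ ∧ c.k = e.2)

/-- One invocation. `E` is the list of the `ε`-nodes that exist at its start, as pairs of the
replaced gate and the value; the result (if Verifier does not reject) is the list at its end. -/
noncomputable def invoke (P : OracleProver n F) (ρ : Fin n → F) (E : List (Gate n × F))
    (B : Batch n F) : Option (List (Gate n × F)) := do
  let C ← B.claims.mapM (normalize P ρ)
  let new := B.gates.map (fun g => (g.conv, askValue P g.conv ρ))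
  let D ← certify P ρ (B.gates.flatMap Gate.block)
    (C.flatten ++ new.map (fun e => ⟨e.1, ρ, e.2⟩))
  if ∀ e ∈ E, checkEps P ρ D e = true then some (E ++ new) else none

/-- Verifier accepts in all invocations, when the random assignment is `ρ`. -/
def Accepts (P : OracleProver n F) (run : List (Batch n F)) (ρ : Fin n → F) : Prop :=
  (run.foldlM (invoke P ρ) []).isSome = true

open Classical in
/-- The probability, over the uniformly random assignment, that Verifier accepts. -/
noncomputable def acceptProb [Fintype F] (P : OracleProver n F) (run : List (Batch n F)) : ℝ :=
  ((Finset.univ.filter (fun ρ : Fin n → F => Accepts P run ρ)).card : ℝ)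
    / (Fintype.card (Fin n → F) : ℝ)

end Verifier

/-! ### Runs -/

/-- `gs` lists new GBC gates in topological order; each successor of a gate comes later in the list
or has been checked before (is in `done`). -/
def IsTopo {n : ℕ} (done : List (Gate n)) : List (Gate n) → Prop
  | [] => True
  | g :: gs =>
      g.IsGBC ∧ g ∉ done ∧ g ∉ gs ∧ (∀ c ∈ g.children, c ∈ gs ∨ c ∈ done) ∧ IsTopo done gs

/-- The invocations process a circuit bottom-up: their sets of gates are disjoint, and the
successors and the gates in claims belong to the same or to an earlier invocation. -/
def IsRun {n : ℕ} {F : Type} (q : ℕ) (done : List (Gate n)) : List (Batch n F) → Prop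
  | [] => True
  | B :: Bs =>
      IsTopo done B.gates ∧ (∀ c ∈ B.claims, c.IsAbout (done ++ B.gates) q)
        ∧ IsRun q (done ++ B.gates) Bs

/-- The number of gates of the circuit, without degree reductions. -/
def size {n : ℕ} {F : Type} (run : List (Batch n F)) : ℕ :=
  (run.map (fun B => B.gates.length)).sum

end GBCCert

/-!
Verifier draws only one assignment `ρ`, so the queries that it sends are heavily correlated, and this
is what makes a union bound work. After a merge, a claim stands at `ρ`. Hence every claim about a
successor stands at `ρ` as well, or, below `π_{[x:=b]}` and `[y/x]`, at a point that differs from `ρ`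
at most in `x`. Moving a claim that already stands at `ρ` costs nothing (`moveClaim_k_of_eq`), and
moving one that differs from `ρ` in `x` alone involves only the query for `ρ` without `x`. So in the
block of a gate only `2n` queries matter (`blockQueries`): at most `n` for the merge at its top and at
most `n` for its degree reductions.

Each of these queries leaves out `x`, so an oracle answers it before `ρ x` is known. A wrong answer of
degree at most two agrees with the truth at `ρ x` (`Lucky`) with probability at most `2 / |F|`
(`prob_lucky_le`), because the true polynomial has degree at most two as well: gates `conv g` are
multilinear, and one binary operation at most doubles the degrees. If no relevant query is lucky,
then in accepting runs the oracle's values of all gates at `ρ` are correct, by induction from the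
leaves upwards (`Certified.valueCorrect`), and every claim that can be moved to `ρ` without luck is
true (`run_sound`). A false claim normalizes to a false evaluation claim, whose move to `ρ` involves
`n` more queries; these are paid for by a leaf of the circuit, which has no degree reductions
(`length_flatMap_blockQueries_le`). The exception is a false equivalence, where Verifier compares two
different multilinear polynomials at `ρ`; they agree there with probability at most `n / |F|`, by
the Schwartz–Zippel lemma. Count claims are faithful because a multilinear polynomial takes at
`(1/2, …, 1/2)` its mean value over the boolean cube (`val_half`), and `2 ^ n < p`.

For completeness, the claims stay true as long as Prover is honest, and true claims about a gate are
merged into a single one. The `ε`-nodes hold the values given by Prover, so whether an invocation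
accepts with true claims does not depend on the truth of earlier claims (`exists_invoke_honest`).
-/

namespace GBCCert

section Values

variable {n : ℕ} {F : Type} [Field F]

/-! ### Values of gates -/

theorem map_opHat {R S : Type} [CommRing R] [CommRing S] (f : R →+* S) (op : Bool → Bool → Bool)
    (a b : R) : f (opHat op a b) = opHat op (f a) (f b) := by
  simp only [opHat, map_add, apply_ite f, map_mul, map_sub, map_one, map_zero]

theorem opHat_bit (op : Bool → Bool → Bool) (a b : Bool) :
    opHat op (bit a : F) (bit b) = bit (op a b) := by
  cases a <;> cases b <;> simp [opHat, bit]

theorem val_top (σ : Fin n → F) : val .top σ = 1 := by simp [val, arith]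

theorem val_bot (σ : Fin n → F) : val .bot σ = 0 := by simp [val, arith]

theorem val_var (x : Fin n) (σ : Fin n → F) : val (.var x) σ = σ x := by simp [val, arith]

theorem val_neg (a : Gate n) (σ : Fin n → F) : val (.neg a) σ = 1 - val a σ := by
  simp [val, arith]

theorem val_bin (op : Bool → Bool → Bool) (a b : Gate n) (σ : Fin n → F) :
    val (.bin op a b) σ = opHat op (val a σ) (val b σ) := by
  simp [val, arith, map_opHat]

theorem eval_bind₁_update (σ : Fin n → F) (x : Fin n) (r q : MvPolynomial (Fin n) F) :
    MvPolynomial.eval σ (MvPolynomial.bind₁ (Function.update MvPolynomial.X x r) q)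
      = MvPolynomial.eval (Function.update σ x (MvPolynomial.eval σ r)) q := by
  have h := MvPolynomial.aeval_bind₁ (R := F) σ (Function.update MvPolynomial.X x r) q
  simp only [MvPolynomial.aeval_eq_eval] at h
  refine h.trans ?_
  congr 1
  congr 1
  funext i
  by_cases hi : i = x
  · subst hi; simp
  · simp [hi]

theorem val_proj (x : Fin n) (b : Bool) (a : Gate n) (σ : Fin n → F) :
    val (.proj x b a) σ = val a (Function.update σ x (bit b)) := by
  simp [val, arith, eval_bind₁_update]

theorem val_ren (y x : Fin n) (a : Gate n) (σ : Fin n → F) :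
    val (.ren y x a) σ = val a (Function.update σ x (σ y)) := by
  simp [val, arith, eval_bind₁_update]

theorem eval_monomial_update (x : Fin n) (m : Fin n →₀ ℕ) (c : F) (k : ℕ) (σ : Fin n → F) :
    MvPolynomial.eval σ (MvPolynomial.monomial (m.update x k) c)
      = c * (σ x ^ k * ∏ i ∈ Finset.univ.erase x, σ i ^ m i) := by
  rw [MvPolynomial.eval_monomial, Finsupp.prod_fintype _ _ (by simp),
    ← Finset.mul_prod_erase _ _ (Finset.mem_univ x)]
  congr 2
  · simp
  · refine Finset.prod_congr rfl fun i hi => ?_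
    simp [Finset.ne_of_mem_erase hi]

/-- On the values of `x`, degree reduction interpolates linearly between `0` and `1`. -/
theorem eval_degRed (x : Fin n) (q : MvPolynomial (Fin n) F) (σ : Fin n → F) :
    MvPolynomial.eval σ (degRed x q)
      = σ x * MvPolynomial.eval (Function.update σ x 1) q
        + (1 - σ x) * MvPolynomial.eval (Function.update σ x 0) q := by
  have key : ∀ τ : Fin n → F, MvPolynomial.eval τ q
      = ∑ m ∈ q.support, q.coeff m * (τ x ^ m x * ∏ i ∈ Finset.univ.erase x, τ i ^ m i) := by
    intro τ
    conv_lhs => rw [q.as_sum]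
    rw [map_sum]
    refine Finset.sum_congr rfl fun m _ => ?_
    have h := eval_monomial_update x m (q.coeff m) (m x) τ
    rwa [Finsupp.update_self] at h
  have hp : ∀ (t : F) (m : Fin n →₀ ℕ),
      ∏ i ∈ Finset.univ.erase x, Function.update σ x t i ^ m i
        = ∏ i ∈ Finset.univ.erase x, σ i ^ m i := fun t m =>
    Finset.prod_congr rfl fun i hi => by simp [Finset.ne_of_mem_erase hi]
  rw [key, key, degRed, map_sum, Finset.mul_sum, Finset.mul_sum, ← Finset.sum_add_distrib]
  refine Finset.sum_congr rfl fun m _ => ?_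
  rw [eval_monomial_update, hp, hp]
  rcases Nat.eq_zero_or_pos (m x) with h | h
  · simp [h]; ring
  · rw [min_eq_right h]
    simp [h.ne']; ring

theorem val_red (x : Fin n) (a : Gate n) (σ : Fin n → F) :
    val (.red x a) σ
      = σ x * val a (Function.update σ x 1) + (1 - σ x) * val a (Function.update σ x 0) := by
  simp [val, arith, eval_degRed]

/-- The value of a gate depends only on the values of its free variables. -/
theorem val_congr (a : Gate n) {σ τ : Fin n → F} (h : ∀ x ∈ a.free, σ x = τ x) :
    val a σ = val a τ := by
  have upd : ∀ (S : Finset (Fin n)) (x : Fin n) (t : F) (σ τ : Fin n → F),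
      (∀ z ∈ S, z ≠ x → σ z = τ z) →
        ∀ z ∈ S, Function.update σ x t z = Function.update τ x t z := by
    intro S x t σ τ h z hz
    by_cases hzx : z = x
    · subst hzx; simp
    · simp [hzx, h z hz hzx]
  induction a generalizing σ τ with
  | top => simp [val_top]
  | bot => simp [val_bot]
  | var x => simpa [val_var] using h x (by simp [Gate.free])
  | neg a ih => rw [val_neg, val_neg, ih h]
  | bin op a b iha ihb =>
    rw [val_bin, val_bin, iha fun x hx => h x (Finset.mem_union_left _ hx),
      ihb fun x hx => h x (Finset.mem_union_right _ hx)]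
  | proj x b a ih =>
    rw [val_proj, val_proj]
    exact ih (upd _ _ _ _ _ fun z hz hzx => h z (Finset.mem_erase.2 ⟨hzx, hz⟩))
  | ren y x a ih =>
    rw [val_ren, val_ren]
    refine ih fun z hz => ?_
    by_cases hzx : z = x
    · subst hzx
      simpa using h y (Finset.mem_image.2 ⟨z, hz, by simp⟩)
    · simpa [hzx] using h z (Finset.mem_image.2 ⟨z, hz, by simp [hzx]⟩)
  | red x a ih =>
    by_cases hxa : x ∈ a.free
    · rw [val_red, val_red, h x hxa]
      rw [ih (upd _ x 1 _ _ fun z hz _ => h z hz), ih (upd _ x 0 _ _ fun z hz _ => h z hz)]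
    · have e : ∀ (t : F) (ρ : Fin n → F), (∀ z ∈ a.free, ρ z = σ z) →
          val a (Function.update ρ x t) = val a σ := fun t ρ hρ => ih fun z hz => by
        have : z ≠ x := fun h => hxa (h ▸ hz)
        simp [this, hρ z hz]
      rw [val_red, val_red, e _ _ fun _ _ => rfl, e _ _ fun _ _ => rfl,
        e _ τ fun z hz => (h z hz).symm, e _ τ fun z hz => (h z hz).symm]
      ring

/-! ### Individual degrees -/

theorem degreeOf_one_sub_le (x : Fin n) (q : MvPolynomial (Fin n) F) :
    (1 - q).degreeOf x ≤ q.degreeOf x := by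
  refine (MvPolynomial.degreeOf_sub_le _ _ _).trans ?_
  simp [MvPolynomial.degreeOf_one]

theorem degreeOf_opHat_le (x : Fin n) (op : Bool → Bool → Bool) (p q : MvPolynomial (Fin n) F) :
    (opHat op p q).degreeOf x ≤ p.degreeOf x + q.degreeOf x := by
  have hp := degreeOf_one_sub_le x p
  have hq := degreeOf_one_sub_le x q
  have hi : ∀ (c : Bool) (r s : MvPolynomial (Fin n) F), r.degreeOf x ≤ p.degreeOf x →
      s.degreeOf x ≤ q.degreeOf x →
      (if c then r * s else 0).degreeOf x ≤ p.degreeOf x + q.degreeOf x := by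
    intro c r s hr hs
    cases c
    · simp
    · simpa using (MvPolynomial.degreeOf_mul_le x r s).trans (add_le_add hr hs)
  unfold opHat
  refine (MvPolynomial.degreeOf_add_le _ _ _).trans (max_le ?_ (hi _ _ _ hp hq))
  refine (MvPolynomial.degreeOf_add_le _ _ _).trans (max_le ?_ (hi _ _ _ hp le_rfl))
  exact (MvPolynomial.degreeOf_add_le _ _ _).trans (max_le (hi _ _ _ le_rfl le_rfl)
    (hi _ _ _ le_rfl hq))

theorem degreeOf_degRed_le (x z : Fin n) (q : MvPolynomial (Fin n) F) :
    (degRed x q).degreeOf z ≤ if z = x then min 1 (q.degreeOf z) else q.degreeOf z := by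
  unfold degRed
  refine (MvPolynomial.degreeOf_sum_le _ _ _).trans (Finset.sup_le fun m hm => ?_)
  have hmz := MvPolynomial.monomial_le_degreeOf z hm
  refine (MvPolynomial.degreeOf_le_iff.2 fun m' hm' => ?_)
  have := MvPolynomial.support_monomial_subset hm'
  rw [Finset.mem_singleton] at this
  subst this
  by_cases hz : z = x
  · subst hz; simp; omega
  · simpa [hz] using hmz

theorem degreeOf_bind₁_le (f : Fin n → MvPolynomial (Fin n) F) (q : MvPolynomial (Fin n) F)
    (z : Fin n) (d : ℕ) (h : ∀ m ∈ q.support, ∑ i, m i * (f i).degreeOf z ≤ d) :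
    (MvPolynomial.bind₁ f q).degreeOf z ≤ d := by
  conv_lhs => rw [q.as_sum, map_sum]
  refine (MvPolynomial.degreeOf_sum_le _ _ _).trans (Finset.sup_le fun m hm => ?_)
  rw [MvPolynomial.bind₁_monomial]
  refine (MvPolynomial.degreeOf_C_mul_le _ _ _).trans ?_
  refine (MvPolynomial.degreeOf_prod_le _ _ _).trans ?_
  refine le_trans ?_ (h m hm)
  refine (Finset.sum_le_sum fun i _ => MvPolynomial.degreeOf_pow_le z (f i) (m i)).trans ?_
  exact Finset.sum_le_sum_of_subset (Finset.subset_univ _)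

theorem degreeOf_bind₁_update_le (x z : Fin n) (r q : MvPolynomial (Fin n) F) :
    (MvPolynomial.bind₁ (Function.update MvPolynomial.X x r) q).degreeOf z
      ≤ q.degreeOf x * r.degreeOf z + if z = x then 0 else q.degreeOf z := by
  refine degreeOf_bind₁_le _ _ _ _ fun m hm => ?_
  rw [← Finset.add_sum_erase _ _ (Finset.mem_univ x)]
  refine add_le_add ?_ ?_
  · simpa using Nat.mul_le_mul_right _ (MvPolynomial.monomial_le_degreeOf x hm)
  · rw [Finset.sum_congr rfl (g := fun i => if i = z then m i else 0) fun i hi => ?_]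
    · by_cases hz : z = x
      · subst hz; simp
      · simpa [hz] using MvPolynomial.monomial_le_degreeOf z hm
    · rw [Function.update_of_ne (Finset.ne_of_mem_erase hi), MvPolynomial.degreeOf_X]
      simp [eq_comm]

/-- The arithmetization involves free variables only; for `a[y/x]` this yields that the degree in `y`
is not more than the degree of `a` in `x`. -/
theorem degreeOf_arith_of_notMem {a : Gate n} {z : Fin n} (hz : z ∉ a.free) :
    (arith F a).degreeOf z = 0 := by
  induction a generalizing z with
  | top => simp [arith]
  | bot => simp [arith]
  | var x =>
    have : z ≠ x := by simpa [Gate.free] using hz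
    simp [arith, MvPolynomial.degreeOf_X, this]
  | neg a ih =>
    exact Nat.le_zero.1 ((degreeOf_one_sub_le z (arith F a)).trans (ih hz).le)
  | bin op a b iha ihb =>
    simp only [Gate.free, Finset.mem_union, not_or] at hz
    exact Nat.le_zero.1 ((degreeOf_opHat_le z op _ _).trans (by rw [iha hz.1, ihb hz.2]))
  | proj x b a ih =>
    refine Nat.le_zero.1 ((degreeOf_bind₁_update_le x z _ _).trans ?_)
    by_cases hzx : z = x
    · simp [hzx, MvPolynomial.degreeOf_C]
    · have : z ∉ a.free := fun h => hz (Finset.mem_erase.2 ⟨hzx, h⟩)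
      simp [hzx, MvPolynomial.degreeOf_C, ih this]
  | ren y x a ih =>
    refine Nat.le_zero.1 ((degreeOf_bind₁_update_le x z _ _).trans ?_)
    have h1 : (arith F a).degreeOf x * (MvPolynomial.X y : MvPolynomial (Fin n) F).degreeOf z
        = 0 := by
      by_cases hx : x ∈ a.free
      · have : z ≠ y := fun h => hz (Finset.mem_image.2 ⟨x, hx, by simp [h]⟩)
        simp [MvPolynomial.degreeOf_X, this]
      · simp [ih hx]
    have h2 : (if z = x then 0 else (arith F a).degreeOf z) = 0 := by
      by_cases hzx : z = x
      · simp [hzx]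
      · have : z ∉ a.free := fun h => hz (Finset.mem_image.2 ⟨z, h, by simp [hzx]⟩)
        simp [hzx, ih this]
    rw [h1, h2]
  | red x a ih =>
    refine Nat.le_zero.1 ((degreeOf_degRed_le x z _).trans ?_)
    rw [ih hz]; simp

/-! ### Degrees in the converted circuit -/

theorem free_redChain (xs : List (Fin n)) (a : Gate n) : (Gate.redChain xs a).free = a.free := by
  induction xs with
  | nil => rfl
  | cons x xs ih => exact ih

theorem free_conv (g : Gate n) : g.conv.free = g.free := by
  induction g with
  | top => rfl
  | bot => rfl
  | var x => rfl
  | neg a ih => exact ih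
  | bin op a b iha ihb => simp [Gate.conv, free_redChain, Gate.free, iha, ihb]
  | proj x b a ih => simp [Gate.conv, Gate.free, ih]
  | ren y x a ih => simp [Gate.conv, Gate.free, ih]
  | red x a ih => simpa [Gate.conv, Gate.free] using ih

theorem mem_freeList {a : Gate n} {x : Fin n} : x ∈ a.freeList ↔ x ∈ a.free := by
  simp [Gate.freeList, List.mem_finRange]

theorem nodup_freeList (a : Gate n) : a.freeList.Nodup :=
  (List.nodup_finRange n).filter _

theorem length_freeList_le (a : Gate n) : a.freeList.length ≤ n :=
  (List.length_filter_le _ _).trans (by simp)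

theorem degreeOf_redChain_le (xs : List (Fin n)) (a : Gate n) (z : Fin n) :
    (arith F (Gate.redChain xs a)).degreeOf z
      ≤ if z ∈ xs then min 1 ((arith F a).degreeOf z) else (arith F a).degreeOf z := by
  induction xs with
  | nil => simp [Gate.redChain]
  | cons x xs ih =>
    have h := degreeOf_degRed_le x z (arith F (Gate.redChain xs a))
    have e : arith F (Gate.redChain (x :: xs) a) = degRed x (arith F (Gate.redChain xs a)) := rfl
    rw [e]
    by_cases hz : z = x <;> by_cases hz' : z ∈ xs <;> simp_all <;> omega

/-- The arithmetization of a gate of the converted circuit that stems from an input gate is linear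
in each variable: this is what the degree reductions are for. -/
theorem degreeOf_conv_le_one {g : Gate n} (hg : g.IsGBC) (z : Fin n) :
    (arith F g.conv).degreeOf z ≤ 1 := by
  induction g generalizing z with
  | top => simp [Gate.conv, arith]
  | bot => simp [Gate.conv, arith]
  | var x =>
    simp only [Gate.conv, arith, MvPolynomial.degreeOf_X]
    split <;> simp
  | neg a ih => exact (degreeOf_one_sub_le _ _).trans (ih hg z)
  | bin op a b iha ihb =>
    refine (degreeOf_redChain_le _ _ z).trans ?_
    split
    · exact min_le_left _ _
    · rename_i h
      rw [degreeOf_arith_of_notMem]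
      · exact Nat.zero_le _
      · simpa [mem_freeList, Gate.free, free_conv] using h
  | proj x b a ih =>
    refine (degreeOf_bind₁_update_le x z _ _).trans ?_
    have := ih hg z
    simp only [MvPolynomial.degreeOf_C]
    split <;> omega
  | ren y x a ih =>
    refine (degreeOf_bind₁_update_le x z _ _).trans ?_
    have hz := ih hg.1 z
    have hx := ih hg.1 x
    have hy : (arith F a.conv).degreeOf y = 0 :=
      degreeOf_arith_of_notMem (by rw [free_conv]; exact hg.2)
    rw [MvPolynomial.degreeOf_X]
    by_cases hzx : z = x <;> by_cases hzy : z = y <;> simp_all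
  | red x a ih => exact hg.elim

theorem degreeOf_redChain_bin_le_two {op : Bool → Bool → Bool} {a b : Gate n} (ha : a.IsGBC)
    (hb : b.IsGBC) (xs : List (Fin n)) (z : Fin n) :
    (arith F (Gate.redChain xs (.bin op a.conv b.conv))).degreeOf z ≤ 2 := by
  have h : (arith F (.bin op a.conv b.conv)).degreeOf z ≤ 2 :=
    (degreeOf_opHat_le z op _ _).trans
      (add_le_add (degreeOf_conv_le_one ha z) (degreeOf_conv_le_one hb z))
  refine (degreeOf_redChain_le _ _ z).trans ?_
  split <;> omega

/-! ### Restriction to a line -/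

/-- The univariate polynomial that the arithmetization of `a` becomes when all variables except
`x` are assigned by `σ`. -/
noncomputable def linePoly (a : Gate n) (σ : Fin n → F) (x : Fin n) : Polynomial F :=
  MvPolynomial.aeval
    (fun y => if y = x then Polynomial.X else Polynomial.C (σ y)) (arith F a)

theorem eval_linePoly (a : Gate n) (σ : Fin n → F) (x : Fin n) (t : F) :
    (linePoly a σ x).eval t = val a (Function.update σ x t) := by
  have h := MvPolynomial.map_aeval
    (fun y => if y = x then (Polynomial.X : Polynomial F) else Polynomial.C (σ y))
    (Polynomial.evalRingHom t) (arith F a)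
  rw [Polynomial.coe_evalRingHom] at h
  rw [linePoly, h, val, MvPolynomial.coe_eval₂Hom]
  have e1 : (Polynomial.evalRingHom t).comp (algebraMap F (Polynomial F)) = RingHom.id F := by
    ext; simp
  have e2 : (fun i => Polynomial.eval t
      (if i = x then (Polynomial.X : Polynomial F) else Polynomial.C (σ i)))
        = Function.update σ x t := by
    funext i
    by_cases hi : i = x
    · subst hi; simp
    · simp [hi]
  rw [e1, e2]
  rfl

theorem natDegree_linePoly_le (a : Gate n) (σ : Fin n → F) (x : Fin n) :
    (linePoly a σ x).natDegree ≤ (arith F a).degreeOf x := by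
  rw [linePoly]
  conv_lhs => rw [(arith F a).as_sum, map_sum]
  refine Polynomial.natDegree_sum_le_of_forall_le _ _ fun m hm => ?_
  have hmx := MvPolynomial.monomial_le_degreeOf x hm
  rw [MvPolynomial.aeval_monomial, Finsupp.prod_fintype _ _ (by simp)]
  refine (Polynomial.natDegree_C_mul_le _ _).trans ?_
  refine (Polynomial.natDegree_prod_le _ _).trans ?_
  rw [Finset.sum_eq_single x]
  · simpa using hmx
  · intro i _ hi
    rw [if_neg hi, ← Polynomial.C_pow, Polynomial.natDegree_C]
  · simp

/-- If the degree in `x` is at most one, then the value is the linear interpolation of those at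
`x = 0` and `x = 1`. -/
theorem val_eq_interpolate {a : Gate n} {x : Fin n} (h : (arith F a).degreeOf x ≤ 1)
    (σ : Fin n → F) :
    val a σ = σ x * val a (Function.update σ x 1) + (1 - σ x) * val a (Function.update σ x 0) := by
  have hq := (natDegree_linePoly_le a σ x).trans h
  obtain ⟨c, d, hcd⟩ := Polynomial.exists_eq_X_add_C_of_natDegree_le_one hq
  have e := eval_linePoly a σ x
  have h0 := e (σ x)
  rw [Function.update_eq_self] at h0
  rw [← h0, ← e 1, ← e 0, hcd]
  simp; ring

/-! ### Boolean functions and satisfying assignments -/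

theorem bit_update (τ : Fin n → Bool) (x : Fin n) (b : Bool) :
    (fun z => (bit (Function.update τ x b z) : F))
      = Function.update (fun z => bit (τ z)) x (bit b) := by
  funext z
  by_cases hz : z = x
  · subst hz; simp
  · simp [hz]

/-- On boolean assignments, the arithmetization is the boolean function. -/
theorem val_bit (a : Gate n) (τ : Fin n → Bool) :
    val a (fun x => (bit (τ x) : F)) = bit (a.fn τ) := by
  induction a generalizing τ with
  | top => simp [val_top, Gate.fn, bit]
  | bot => simp [val_bot, Gate.fn, bit]
  | var x => simp [val_var, Gate.fn]
  | neg a ih =>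
    rw [val_neg, ih, Gate.fn]
    cases a.fn τ <;> simp [bit]
  | bin op a b iha ihb => rw [val_bin, iha, ihb, opHat_bit, Gate.fn]
  | proj x b a ih => rw [val_proj, ← bit_update, ih, Gate.fn]
  | ren y x a ih => rw [val_ren, ← bit_update, ih, Gate.fn]
  | red x a ih =>
    rw [val_red, Gate.fn, ← ih τ]
    have hu : ∀ t : F, bit (τ x) = t → val a (Function.update (fun z => (bit (τ z) : F)) x t)
        = val a (fun z => (bit (τ z) : F)) := fun t ht => by
      rw [Function.update_eq_self_iff.2 ht.symm]
    cases h : τ x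
    · rw [hu 0 (by simp [h, bit]), bit]; simp
    · rw [hu 1 (by simp [h, bit]), bit]; simp

theorem bit_injective : Function.Injective (bit : Bool → F) := by
  intro a b h
  cases a <;> cases b <;> simp_all [bit]

/-- Multilinear functions that agree on the boolean cube agree everywhere. -/
theorem val_eq_of_fn_eq {a b : Gate n} (ha : ∀ x, (arith F a).degreeOf x ≤ 1)
    (hb : ∀ x, (arith F b).degreeOf x ≤ 1) (h : a.fn = b.fn) (σ : Fin n → F) :
    val a σ = val b σ := by
  -- Induction on the set of the variables that may have a value other than `0` and `1`.
  have key : ∀ (S : Finset (Fin n)) (σ : Fin n → F),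
      (∀ x ∉ S, σ x = 0 ∨ σ x = 1) → val a σ = val b σ := by
    intro S
    induction S using Finset.induction_on with
    | empty =>
      intro σ hσ
      classical
      have : σ = fun x => bit (decide (σ x = 1)) := by
        funext x
        rcases hσ x (by simp) with h | h <;> simp [h, bit]
      rw [this, val_bit, val_bit, h]
    | insert x S hx ih =>
      intro σ hσ
      rw [val_eq_interpolate (ha x), val_eq_interpolate (hb x)]
      have hu : ∀ t : F, t = 0 ∨ t = 1 → val a (Function.update σ x t)
          = val b (Function.update σ x t) := fun t ht => ih _ fun z hz => by
        by_cases hzx : z = x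
        · subst hzx; simpa using ht
        · simpa [hzx] using hσ z (by simp [hz, hzx])
      rw [hu 0 (Or.inl rfl), hu 1 (Or.inr rfl)]
  exact key Finset.univ σ (by simp)

/-- The number of assignments of the variables in `S`, extended by `τ` to the other variables, that
satisfy `a`. -/
def satCountOn (a : Gate n) (S : Finset (Fin n)) (τ : Fin n → Bool) : ℕ :=
  (Finset.univ.filter (fun τ' : Fin n → Bool =>
    (∀ x, x ∉ S → τ' x = τ x) ∧ a.fn τ' = true)).card

theorem satCountOn_insert (a : Gate n) {S : Finset (Fin n)} {x : Fin n} (hx : x ∉ S)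
    (τ : Fin n → Bool) :
    satCountOn a (insert x S) τ
      = satCountOn a S (Function.update τ x true) + satCountOn a S (Function.update τ x false) := by
  unfold satCountOn
  rw [← Finset.card_union_of_disjoint]
  · congr 1
    ext τ'
    simp only [Finset.mem_filter, Finset.mem_univ, true_and, Finset.mem_union, Finset.mem_insert,
      not_or]
    constructor
    · rintro ⟨h, hs⟩
      cases hb : τ' x
      · refine Or.inr ⟨fun z hz => ?_, hs⟩
        by_cases hzx : z = x
        · subst hzx; simpa using hb
        · simpa [hzx] using h z ⟨hzx, hz⟩
      · refine Or.inl ⟨fun z hz => ?_, hs⟩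
        by_cases hzx : z = x
        · subst hzx; simpa using hb
        · simpa [hzx] using h z ⟨hzx, hz⟩
    · rintro (⟨h, hs⟩ | ⟨h, hs⟩) <;>
        exact ⟨fun z hz => by simpa [hz.1] using h z hz.2, hs⟩
  · rw [Finset.disjoint_left]
    intro τ' h1 h2
    simp only [Finset.mem_filter, Finset.mem_univ, true_and] at h1 h2
    have e1 := h1.1 x hx
    have e2 := h2.1 x hx
    simp_all

/-- The mean value of a multilinear function over the boolean cube is its value at the midpoint;
here only the variables in `S` are averaged. -/
theorem val_half_mul_two_pow {a : Gate n} (ha : ∀ x, (arith F a).degreeOf x ≤ 1)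
    (h2 : n ≠ 0 → (2 : F) ≠ 0) (S : Finset (Fin n)) (τ : Fin n → Bool) :
    val a (fun x => if x ∈ S then (2 : F)⁻¹ else bit (τ x)) = satCountOn a S τ * 2⁻¹ ^ S.card := by
  induction S using Finset.induction_on generalizing τ with
  | empty =>
    simp only [Finset.notMem_empty, if_false, Finset.card_empty, pow_zero, mul_one]
    rw [val_bit, satCountOn]
    have : (Finset.univ.filter (fun τ' : Fin n → Bool =>
        (∀ x, x ∉ (∅ : Finset (Fin n)) → τ' x = τ x) ∧ a.fn τ' = true))
          = if a.fn τ then {τ} else ∅ := by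
      ext τ'
      have : (∀ x, τ' x = τ x) ↔ τ' = τ := funext_iff.symm
      split <;> rename_i h <;> simp [this]
      · rintro rfl; exact h
      · rintro rfl; simpa using h
    rw [this]
    cases a.fn τ <;> simp [bit]
  | insert x S hx ih =>
    have hn : n ≠ 0 := by rintro rfl; exact x.elim0
    have h2 := h2 hn
    have e : ∀ b : Bool, Function.update
        (fun z => if z ∈ insert x S then (2 : F)⁻¹ else bit (τ z)) x (bit b)
          = fun z => if z ∈ S then (2 : F)⁻¹ else bit (Function.update τ x b z) := by
      intro b
      funext z
      by_cases hzx : z = x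
      · subst hzx; simp [hx]
      · simp [hzx]
    have e1 := e true
    have e0 := e false
    simp only [bit, if_true, Bool.false_eq_true, if_false] at e1 e0
    rw [val_eq_interpolate (ha x)]
    simp only [bit]
    rw [e1, e0, satCountOn_insert a hx, Finset.card_insert_of_notMem hx]
    have i1 := ih (Function.update τ x true)
    have i0 := ih (Function.update τ x false)
    simp only [bit] at i1 i0
    rw [i1, i0]
    simp
    field_simp
    ring

/-- The normalization of a count claim: the value at the midpoint of the cube. (In characteristic
two the midpoint is a junk value, but `2 ^ n < p` leaves this case only for `n = 0`.) -/
theorem val_half {a : Gate n} (ha : ∀ x, (arith F a).degreeOf x ≤ 1)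
    (h2 : n ≠ 0 → (2 : F) ≠ 0) :
    val a (fun _ => (2 : F)⁻¹) = a.satCount * 2⁻¹ ^ a.free.card := by
  have h := val_half_mul_two_pow ha h2 a.free (fun _ => false)
  rw [val_congr a (τ := fun x => if x ∈ a.free then (2 : F)⁻¹ else bit ((fun _ => false) x)), h]
  · rfl
  · intro x hx; simp [hx]

theorem satCount_le (a : Gate n) : a.satCount ≤ 2 ^ n :=
  (Finset.card_filter_le _ _).trans (by simp)

end Values

/-! ### Probabilities over a random assignment -/

section Probability

variable {n : ℕ} {F : Type} [Fintype F]

open Classical in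
/-- The probability of an event, over the uniformly random assignment. -/
noncomputable def prob (A : (Fin n → F) → Prop) : ℝ :=
  ((Finset.univ.filter A).card : ℝ) / (Fintype.card (Fin n → F) : ℝ)

theorem prob_mono {A B : (Fin n → F) → Prop} (h : ∀ ρ, A ρ → B ρ) : prob A ≤ prob B := by
  classical
  unfold prob
  refine div_le_div_of_nonneg_right ?_ (Nat.cast_nonneg _)
  exact_mod_cast Finset.card_le_card (Finset.monotone_filter_right _ fun ρ _ => h ρ)

theorem prob_false : prob (fun _ : Fin n → F => False) = 0 := by simp [prob]

theorem prob_true [Nonempty F] : prob (fun _ : Fin n → F => True) = 1 := by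
  simp [prob, Fintype.card_ne_zero]

theorem prob_or_le (A B : (Fin n → F) → Prop) :
    prob (fun ρ => A ρ ∨ B ρ) ≤ prob A + prob B := by
  classical
  unfold prob
  rw [← add_div]
  gcongr
  norm_cast
  refine le_trans (Finset.card_le_card fun ρ hρ => ?_) (Finset.card_union_le _ _)
  simpa using hρ

theorem prob_exists_mem_le {ι : Type} (l : List ι) (A : ι → (Fin n → F) → Prop) (c : ℝ)
    (h : ∀ i ∈ l, prob (A i) ≤ c) : prob (fun ρ => ∃ i ∈ l, A i ρ) ≤ l.length * c := by
  induction l with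
  | nil => simp [prob_false]
  | cons i l ih =>
    have h1 := ih fun j hj => h j (List.mem_cons_of_mem _ hj)
    have h2 := h i List.mem_cons_self
    have h3 := prob_or_le (A i) (fun ρ => ∃ i ∈ l, A i ρ)
    have e : (fun ρ => ∃ j ∈ i :: l, A j ρ) = fun ρ => A i ρ ∨ ∃ j ∈ l, A j ρ := by
      funext ρ; simp
    rw [e]
    push_cast [List.length_cons]
    linarith

/-- If, whatever the other coordinates are, at most `d` values of `ρ x` lead to the event, then
its probability is at most `d / |F|`. -/
theorem prob_le_of_fiber [Nonempty F] (A : (Fin n → F) → Prop) (x : Fin n) (d : ℕ)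
    (h : ∀ ρ : Fin n → F, ∃ s : Finset F, s.card ≤ d ∧ ∀ t, A (Function.update ρ x t) → t ∈ s) :
    prob A ≤ d / Fintype.card F := by
  classical
  have key : Fintype.card F * (Finset.univ.filter A).card ≤ Fintype.card (Fin n → F) * d := by
    -- Count the pairs `(ρ, t)` with `A (ρ[x ↦ t])`; `(ρ, t) ↦ (ρ[x ↦ t], ρ x)` is an involution.
    have e1 : Fintype.card F * (Finset.univ.filter A).card
        = (Finset.univ.filter fun z : (Fin n → F) × F => A (Function.update z.1 x z.2)).card := by
      rw [mul_comm, ← Finset.card_univ (α := F), ← Finset.card_product]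
      refine Finset.card_bij' (fun z _ => (Function.update z.1 x z.2, z.1 x))
        (fun z _ => (Function.update z.1 x z.2, z.1 x)) ?_ ?_ ?_ ?_
      · intro z hz
        simpa using hz
      · intro z hz
        simpa using hz
      · intro z _; simp
      · intro z _; simp
    rw [e1, ← Finset.card_univ (α := Fin n → F)]
    have e2 := Finset.card_eq_sum_card_fiberwise (f := Prod.fst)
      (s := Finset.univ.filter fun z : (Fin n → F) × F => A (Function.update z.1 x z.2))
      (t := Finset.univ) (fun _ _ => Finset.mem_coe.2 (Finset.mem_univ _))
    rw [e2]
    refine Finset.sum_le_card_nsmul _ _ _ fun ρ _ => ?_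
    obtain ⟨s, hs, hA⟩ := h ρ
    refine le_trans (Finset.card_le_card_of_injOn Prod.snd (t := s) ?_ ?_) hs
    · rintro ⟨ρ', t⟩ hz
      simp only [Finset.coe_filter, Finset.mem_filter, Finset.mem_univ, true_and,
        Set.mem_ofPred_eq] at hz
      obtain ⟨hz, rfl⟩ := hz
      exact hA t hz
    · rintro ⟨ρ1, t1⟩ h1 ⟨ρ2, t2⟩ h2 h12
      simp only [Finset.coe_filter, Finset.mem_filter, Finset.mem_univ, true_and,
        Set.mem_ofPred_eq] at h1 h2 h12
      rw [h1.2, h2.2, h12]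
  have hF : (0 : ℝ) < Fintype.card F := by exact_mod_cast Fintype.card_pos
  have hn : (0 : ℝ) < Fintype.card (Fin n → F) := by exact_mod_cast Fintype.card_pos
  unfold prob
  rw [div_le_div_iff₀ hn hF]
  have : ((Fintype.card F * (Finset.univ.filter A).card : ℕ) : ℝ)
    ≤ ((Fintype.card (Fin n → F) * d : ℕ) : ℝ) := by exact_mod_cast key
  push_cast at this ⊢
  linarith

/-- The Schwartz–Zippel bound for multilinear polynomials. -/
theorem prob_eval_eq_zero_le [Field F] {q : MvPolynomial (Fin n) F} (hq : q ≠ 0)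
    (hd : ∀ x, q.degreeOf x ≤ 1) :
    prob (fun ρ => MvPolynomial.eval ρ q = 0) ≤ n / Fintype.card F := by
  classical
  have h := MvPolynomial.schwartz_zippel_sum_degreeOf hq (fun _ => Finset.univ)
  have h1 : ∑ i, (q.degreeOf i / (Finset.univ : Finset F).card : ℚ≥0)
      ≤ ∑ _i : Fin n, (1 / (Finset.univ : Finset F).card : ℚ≥0) :=
    Finset.sum_le_sum fun i _ => by
      gcongr
      exact_mod_cast hd i
  have h2 := h.trans h1
  rw [Finset.sum_const, Finset.prod_const, Finset.card_univ, Finset.card_univ, Fintype.card_fin,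
    nsmul_eq_mul, mul_one_div] at h2
  have h3 := (NNRat.cast_le (K := ℝ)).2 h2
  push_cast at h3
  unfold prob
  refine le_trans (le_of_eq ?_) h3
  rw [Fintype.card_fun, Fintype.card_fin]
  push_cast
  congr 3

end Probability

/-! ### Lucky challenges -/

section Lucky

theorem restrict_congr {n : ℕ} {F : Type} {S : Finset (Fin n)} {σ τ : Fin n → F}
    (h : ∀ z ∈ S, σ z = τ z) : restrict S σ = restrict S τ := by
  funext z
  by_cases hz : z ∈ S
  · simp [restrict, hz, h z hz]
  · simp [restrict, hz]

variable {n : ℕ} {F : Type} [Field F]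

/-- The oracle answers the query for the gate `a` at `σ` without `x` by a wrong polynomial of
degree at most two, which agrees with the correct one at `r`. -/
def Lucky (P : OracleProver n F) (a : Gate n) (x : Fin n) (σ : Fin n → F) (r : F) : Prop :=
  (P.poly a (restrict (a.free.erase x) σ) x).natDegree ≤ 2 ∧
    (∃ t, (P.poly a (restrict (a.free.erase x) σ) x).eval t ≠ val a (Function.update σ x t)) ∧
    (P.poly a (restrict (a.free.erase x) σ) x).eval r = val a (Function.update σ x r)

theorem val_update_congr {a : Gate n} {x : Fin n} {σ τ : Fin n → F}
    (h : ∀ z ∈ a.free, z ≠ x → σ z = τ z) (t : F) :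
    val a (Function.update σ x t) = val a (Function.update τ x t) := by
  refine val_congr a fun z hz => ?_
  by_cases hzx : z = x
  · subst hzx; simp
  · simp [hzx, h z hz hzx]

theorem Lucky.congr {P : OracleProver n F} {a : Gate n} {x : Fin n} {σ τ : Fin n → F} {r : F}
    (hσ : ∀ z ∈ a.free, z ≠ x → σ z = τ z) (h : Lucky P a x σ r) : Lucky P a x τ r := by
  have e : restrict (a.free.erase x) σ = restrict (a.free.erase x) τ :=
    restrict_congr fun z hz => hσ z (Finset.mem_of_mem_erase hz) (Finset.ne_of_mem_erase hz)
  simpa only [Lucky, e, val_update_congr hσ] using h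

/-- A lucky challenge is a root of a nonzero polynomial of degree at most two. -/
theorem exists_card_le_two_of_lucky (P : OracleProver n F) {a : Gate n} {x : Fin n}
    (ha : (arith F a).degreeOf x ≤ 2) (σ : Fin n → F) :
    ∃ s : Finset F, s.card ≤ 2 ∧ ∀ r, Lucky P a x σ r → r ∈ s := by
  classical
  set q := P.poly a (restrict (a.free.erase x) σ) x - linePoly a σ x with hq
  refine ⟨if q.natDegree ≤ 2 then q.roots.toFinset else ∅, ?_, ?_⟩
  · split
    · rename_i h
      exact (Multiset.toFinset_card_le _).trans ((Polynomial.card_roots' _).trans h)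
    · simp
  · rintro r ⟨hd, ⟨t, ht⟩, hr⟩
    have hqd : q.natDegree ≤ 2 := (Polynomial.natDegree_sub_le _ _).trans
      (max_le hd ((natDegree_linePoly_le a σ x).trans ha))
    rw [if_pos hqd, Multiset.mem_toFinset, Polynomial.mem_roots]
    · simp [hq, Polynomial.IsRoot, eval_linePoly, hr]
    · intro h0
      apply ht
      rw [← eval_linePoly, ← sub_eq_zero, ← Polynomial.eval_sub, ← hq, h0, Polynomial.eval_zero]

/-- The oracle is fixed before the challenge `ρ x` is drawn, so it is lucky with probability at
most `2 / |F|`, provided that the query does not depend on `ρ x`. -/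
theorem prob_lucky_le [Fintype F] (P : OracleProver n F) {a : Gate n} {x : Fin n}
    (ha : (arith F a).degreeOf x ≤ 2) (s : (Fin n → F) → (Fin n → F))
    (hs : ∀ ρ t, ∀ z, z ≠ x → s (Function.update ρ x t) z = s ρ z) :
    prob (fun ρ => Lucky P a x (s ρ) (ρ x)) ≤ 2 / Fintype.card F := by
  refine (prob_le_of_fiber _ x 2 fun ρ => ?_).trans (by norm_num)
  obtain ⟨S, hS, hL⟩ := exists_card_le_two_of_lucky P ha (s ρ)
  refine ⟨S, hS, fun t ht => hL t ?_⟩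
  rw [Function.update_self] at ht
  exact ht.congr fun z _ hz => hs ρ t z hz

/-- No challenge is lucky while a claim about `a` at `σ` is moved to `ρ`, one variable after the
other. Variables for which `σ` and `ρ` agree do not matter. -/
def MoveUnlucky (P : OracleProver n F) (a : Gate n) (ρ : Fin n → F) :
    List (Fin n) → (Fin n → F) → Prop
  | [], _ => True
  | x :: xs, σ => (σ x ≠ ρ x → ¬ Lucky P a x σ (ρ x)) ∧
      MoveUnlucky P a ρ xs (Function.update σ x (ρ x))

theorem moveUnlucky_of_eq (P : OracleProver n F) (a : Gate n) {ρ : Fin n → F} (xs : List (Fin n))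
    {σ : Fin n → F} (h : ∀ x ∈ xs, σ x = ρ x) : MoveUnlucky P a ρ xs σ := by
  induction xs with
  | nil => trivial
  | cons x xs ih =>
    have hx := h x List.mem_cons_self
    refine ⟨fun h' => (h' hx).elim, ?_⟩
    rw [← hx, Function.update_eq_self]
    exact ih fun z hz => h z (List.mem_cons_of_mem _ hz)

/-- If `σ` and `ρ` differ in one variable only, then only the query for `ρ` without this variable
matters. -/
theorem moveUnlucky_of_eq_off (P : OracleProver n F) {a : Gate n} {ρ : Fin n → F} (y : Fin n)
    (xs : List (Fin n)) {σ : Fin n → F} (hxs : ∀ x ∈ xs, x ∈ a.free)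
    (h : ∀ z ∈ a.free, z ≠ y → σ z = ρ z) (hL : ∀ x ∈ a.free, ¬ Lucky P a x ρ (ρ x)) :
    MoveUnlucky P a ρ xs σ := by
  induction xs generalizing σ with
  | nil => trivial
  | cons x xs ih =>
    have hxf := hxs x List.mem_cons_self
    refine ⟨fun h' hl => ?_, ih (fun z hz => hxs z (List.mem_cons_of_mem _ hz)) fun z hz hzy => ?_⟩
    · have hxy : x = y := by
        by_contra hne
        exact h' (h x hxf hne)
      subst hxy
      exact hL x hxf (hl.congr h)
    · by_cases hzx : z = x
      · subst hzx; simp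
      · simp [hzx, h z hz hzy]

theorem prob_not_moveUnlucky_le [Fintype F] (P : OracleProver n F) {a : Gate n}
    (ha : ∀ x, (arith F a).degreeOf x ≤ 2) (xs : List (Fin n)) (hxs : xs.Nodup)
    (s : (Fin n → F) → (Fin n → F))
    (hs : ∀ x ∈ xs, ∀ ρ t, s (Function.update ρ x t) = s ρ) :
    prob (fun ρ => ¬ MoveUnlucky P a ρ xs (s ρ)) ≤ xs.length * (2 / Fintype.card F) := by
  induction xs generalizing s with
  | nil => simp [MoveUnlucky, prob_false]
  | cons x xs ih =>
    rw [List.nodup_cons] at hxs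
    have h1 := prob_lucky_le P (ha x) s fun ρ t z _ => by rw [hs x List.mem_cons_self]
    have h2 := ih hxs.2 (fun ρ => Function.update (s ρ) x (ρ x)) fun z hz ρ t => by
      have hzx : x ≠ z := fun h => hxs.1 (h ▸ hz)
      simp only [hs z (List.mem_cons_of_mem _ hz), Function.update_of_ne hzx]
    have h3 : prob (fun ρ => ¬ MoveUnlucky P a ρ (x :: xs) (s ρ)) ≤ _ :=
      (prob_mono (fun ρ h => by
        simp only [MoveUnlucky, not_and_or] at h
        exact h.imp (fun h => by push Not at h; exact h.2) id)).trans
        (prob_or_le (fun ρ => Lucky P a x (s ρ) (ρ x)) _)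
    push_cast [List.length_cons]
    linarith

/-! ### Merging -/

theorem askPoly_eq_some_iff {P : OracleProver n F} {a : Gate n} {σ : Fin n → F} {x : Fin n}
    {q : Polynomial F} :
    askPoly P a σ x = some q ↔
      P.poly a (restrict (a.free.erase x) σ) x = q ∧ q.natDegree ≤ 2 := by
  unfold askPoly
  simp only
  split <;> rename_i h
  · simp only [Option.some.injEq]
    exact ⟨fun e => ⟨e, e ▸ h⟩, fun e => e.1⟩
  · simp only [reduceCtorEq, false_iff, not_and]
    rintro rfl; exact h

/-- If the challenge `r` is not lucky and the answer is right at `r`, then it is right. -/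
theorem eval_eq_val_of_not_lucky {P : OracleProver n F} {a : Gate n} {σ : Fin n → F} {x : Fin n}
    {q : Polynomial F} {r : F} (hq : askPoly P a σ x = some q) (hL : ¬ Lucky P a x σ r)
    (hr : q.eval r = val a (Function.update σ x r)) (t : F) :
    q.eval t = val a (Function.update σ x t) := by
  rw [askPoly_eq_some_iff] at hq
  obtain ⟨rfl, hd⟩ := hq
  by_contra ht
  exact hL ⟨hd, ⟨t, ht⟩, hr⟩

section Merge

variable [DecidableEq F]

/-- The claim that is left when `merge` has moved the single claim `c` along the variables `xs`. -/
noncomputable def moveClaim (P : OracleProver n F) (ρ : Fin n → F) (xs : List (Fin n))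
    (c : EvalClaim n F) : Option (EvalClaim n F) :=
  xs.foldlM (fun c x => mergeClaim P ρ x c) c

/-- The claim is true. -/
def EvalClaim.Holds (c : EvalClaim n F) : Prop := val c.gate c.σ = c.k

theorem mapM_bind_mapM {α β γ : Type} (f : α → Option β) (g : β → Option γ) (l : List α) :
    (l.mapM f >>= fun l' => l'.mapM g) = l.mapM fun c => f c >>= g := by
  induction l with
  | nil => simp
  | cons a l ih =>
    simp only [List.mapM_cons]
    rw [← ih]
    cases hf : f a with
    | none => simp
    | some b =>
      cases l.mapM f with
      | none => cases hg : g b <;> simp [hg]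
      | some l' => simp

theorem mapM_eq_some_iff {α β : Type} {f : α → Option β} {l : List α} {l' : List β} :
    l.mapM f = some l' ↔ List.Forall₂ (fun a b => f a = some b) l l' := by
  induction l generalizing l' with
  | nil => simp [eq_comm]
  | cons a l ih =>
    simp only [List.mapM_cons, List.forall₂_cons_left_iff, ← ih]
    cases hf : f a with
    | none => simp
    | some b =>
      cases hl : l.mapM f with
      | none => simp
      | some m => simp [eq_comm]

theorem exists_of_mapM_eq_some {α β : Type} {f : α → Option β} {l : List α} {l' : List β}
    (h : l.mapM f = some l') {a : α} (ha : a ∈ l) : ∃ b ∈ l', f a = some b := by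
  induction mapM_eq_some_iff.1 h with
  | nil => simp at ha
  | cons hab _ ih =>
    rename_i hl
    rcases List.mem_cons.1 ha with rfl | ha
    · exact ⟨_, List.mem_cons_self, hab⟩
    · obtain ⟨b, hb, hab⟩ := ih (mapM_eq_some_iff.2 hl) ha
      exact ⟨b, List.mem_cons_of_mem _ hb, hab⟩

/-- Merging treats the claims about a gate independently of each other. -/
theorem foldlM_mergeClaim (P : OracleProver n F) (ρ : Fin n → F) (xs : List (Fin n))
    (C : List (EvalClaim n F)) :
    xs.foldlM (fun E x => E.mapM (mergeClaim P ρ x)) C = C.mapM (moveClaim P ρ xs) := by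
  induction xs generalizing C with
  | nil =>
    have : moveClaim P ρ [] = (pure : EvalClaim n F → Option _) := by funext c; rfl
    rw [this, List.mapM_pure]
    simp
  | cons x xs ih =>
    rw [List.foldlM_cons]
    simp only [ih]
    rw [mapM_bind_mapM]
    rfl

theorem mergeClaim_eq_some_iff {P : OracleProver n F} {ρ : Fin n → F} {x : Fin n}
    {c c' : EvalClaim n F} :
    mergeClaim P ρ x c = some c' ↔ ∃ q, askPoly P c.gate c.σ x = some q ∧ q.eval (c.σ x) = c.k ∧
      c' = ⟨c.gate, Function.update c.σ x (ρ x), q.eval (ρ x)⟩ := by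
  unfold mergeClaim
  cases askPoly P c.gate c.σ x with
  | none => simp
  | some q =>
    simp only [Option.bind_eq_bind, Option.bind_some, Option.some.injEq, exists_eq_left']
    split <;> simp_all [eq_comm]

theorem moveClaim_cons_eq_some_iff {P : OracleProver n F} {ρ : Fin n → F} {x : Fin n}
    {xs : List (Fin n)} {c c' : EvalClaim n F} :
    moveClaim P ρ (x :: xs) c = some c' ↔
      ∃ d, mergeClaim P ρ x c = some d ∧ moveClaim P ρ xs d = some c' := by
  simp [moveClaim, List.foldlM_cons, Option.bind_eq_some_iff]

theorem moveClaim_gate {P : OracleProver n F} {ρ : Fin n → F} {xs : List (Fin n)}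
    {c c' : EvalClaim n F} (h : moveClaim P ρ xs c = some c') : c'.gate = c.gate := by
  induction xs generalizing c with
  | nil => simp only [moveClaim, List.foldlM_nil, Option.pure_def, Option.some.injEq] at h; rw [h]
  | cons x xs ih =>
    obtain ⟨d, hd, h⟩ := moveClaim_cons_eq_some_iff.1 h
    obtain ⟨q, -, -, rfl⟩ := mergeClaim_eq_some_iff.1 hd
    exact (ih h :)

theorem moveClaim_σ {P : OracleProver n F} {ρ : Fin n → F} {xs : List (Fin n)}
    {c c' : EvalClaim n F} (h : moveClaim P ρ xs c = some c') (z : Fin n)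
    (hz : z ∈ xs ∨ c.σ z = ρ z) : c'.σ z = ρ z := by
  induction xs generalizing c with
  | nil =>
    simp only [moveClaim, List.foldlM_nil, Option.pure_def, Option.some.injEq] at h
    rw [← h]; simpa using hz
  | cons x xs ih =>
    obtain ⟨d, hd, h⟩ := moveClaim_cons_eq_some_iff.1 h
    obtain ⟨q, -, -, rfl⟩ := mergeClaim_eq_some_iff.1 hd
    refine ih h ?_
    by_cases hzx : z = x
    · subst hzx; simp
    · simpa [hzx] using hz

/-- Claims that are already at `ρ` do not change. -/
theorem moveClaim_k_of_eq {P : OracleProver n F} {ρ : Fin n → F} {xs : List (Fin n)}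
    {c c' : EvalClaim n F} (h : moveClaim P ρ xs c = some c') (hc : ∀ x ∈ xs, c.σ x = ρ x) :
    c'.k = c.k := by
  induction xs generalizing c with
  | nil => simp only [moveClaim, List.foldlM_nil, Option.pure_def, Option.some.injEq] at h; rw [h]
  | cons x xs ih =>
    obtain ⟨d, hd, h⟩ := moveClaim_cons_eq_some_iff.1 h
    obtain ⟨q, -, hk, rfl⟩ := mergeClaim_eq_some_iff.1 hd
    have hx := hc x List.mem_cons_self
    have e : (⟨c.gate, Function.update c.σ x (ρ x), q.eval (ρ x)⟩ : EvalClaim n F) = c := by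
      rw [← hx, Function.update_eq_self, hk]
    rw [e] at h
    exact ih h fun z hz => hc z (List.mem_cons_of_mem _ hz)

/-- Without luck, a claim is true if it is moved to a true one. -/
theorem holds_of_moveClaim {P : OracleProver n F} {ρ : Fin n → F} {xs : List (Fin n)}
    {c c' : EvalClaim n F} (h : moveClaim P ρ xs c = some c')
    (hu : MoveUnlucky P c.gate ρ xs c.σ) (hc' : c'.Holds) : c.Holds := by
  induction xs generalizing c with
  | nil => simp only [moveClaim, List.foldlM_nil, Option.pure_def, Option.some.injEq] at h; rwa [h]
  | cons x xs ih =>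
    obtain ⟨d, hd, h⟩ := moveClaim_cons_eq_some_iff.1 h
    obtain ⟨q, hq, hk, rfl⟩ := mergeClaim_eq_some_iff.1 hd
    have hd : val c.gate (Function.update c.σ x (ρ x)) = q.eval (ρ x) :=
      ih (c := ⟨c.gate, Function.update c.σ x (ρ x), q.eval (ρ x)⟩) h hu.2
    rw [EvalClaim.Holds, ← hk]
    by_cases hx : c.σ x = ρ x
    · rw [hx, ← hd, ← hx, Function.update_eq_self]
    · rw [eval_eq_val_of_not_lucky hq (hu.1 hx) hd.symm, Function.update_eq_self]

theorem merge_eq_some_iff {P : OracleProver n F} {ρ : Fin n → F} {a : Gate n}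
    {C : List (EvalClaim n F)} {c : EvalClaim n F} :
    merge P ρ a C = some c ↔ ∃ D, List.Forall₂ (fun e d => moveClaim P ρ a.freeList e = some d) C D ∧
      ∃ D', D = c :: D' ∧ ∀ d ∈ D', restrict a.free d.σ = restrict a.free c.σ ∧ d.k = c.k := by
  unfold merge
  rw [foldlM_mergeClaim]
  simp only [← mapM_eq_some_iff]
  cases List.mapM (moveClaim P ρ a.freeList) C with
  | none => simp
  | some D =>
    cases D with
    | nil => simp
    | cons d D =>
      simp only [Option.bind_eq_bind, Option.bind_some, Option.some.injEq, exists_eq_left']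
      split
      · rename_i h
        simp only [Option.some.injEq]
        constructor
        · rintro rfl; exact ⟨D, rfl, h⟩
        · rintro ⟨D', h', -⟩; exact (List.cons.inj h').1
      · rename_i h
        simp only [reduceCtorEq, false_iff]
        rintro ⟨D', h', h''⟩
        obtain ⟨h1, h2⟩ := List.cons.inj h'
        subst h1 h2
        exact h h''

theorem moveClaim_of_merge {P : OracleProver n F} {ρ : Fin n → F} {a : Gate n}
    {C : List (EvalClaim n F)} {c : EvalClaim n F} (h : merge P ρ a C = some c) :
    (∀ z ∈ a.free, c.σ z = ρ z) ∧ (∃ e ∈ C, c.gate = e.gate) ∧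
      ∀ e ∈ C, ∃ d, moveClaim P ρ a.freeList e = some d ∧ (∀ z ∈ a.free, d.σ z = ρ z)
        ∧ d.k = c.k := by
  obtain ⟨D, hD, D', rfl, hD'⟩ := merge_eq_some_iff.1 h
  have hσ : ∀ {e d : EvalClaim n F}, moveClaim P ρ a.freeList e = some d →
      ∀ z ∈ a.free, d.σ z = ρ z := fun h z hz => moveClaim_σ h z (Or.inl (mem_freeList.2 hz))
  obtain ⟨e, C', he, hC', rfl⟩ := List.forall₂_cons_right_iff.1 hD
  refine ⟨hσ he, ⟨e, List.mem_cons_self, moveClaim_gate he⟩, fun e' he' => ?_⟩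
  rcases List.mem_cons.1 he' with rfl | he'
  · exact ⟨c, he, hσ he, rfl⟩
  · obtain ⟨d, hd, hd'⟩ := exists_of_mapM_eq_some (mapM_eq_some_iff.2 hC') he'
    exact ⟨d, hd', hσ hd', (hD' d hd).2⟩

end Merge

end Lucky

/-! ### The blocks of the converted circuit -/

section Blocks

variable {n : ℕ}

/-- The gate without its degree reductions: `origin` is a left inverse of `conv`, and constant on
each block. -/
def Gate.origin : Gate n → Gate n
  | .top => .top
  | .bot => .bot
  | .var x => .var x
  | .neg a => .neg a.origin
  | .bin op a b => .bin op a.origin b.origin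
  | .proj x b a => .proj x b a.origin
  | .ren y x a => .ren y x a.origin
  | .red _ a => a.origin

theorem origin_redChain (xs : List (Fin n)) (a : Gate n) :
    (Gate.redChain xs a).origin = a.origin := by
  induction xs with
  | nil => rfl
  | cons x xs ih => exact ih

theorem origin_conv {g : Gate n} (hg : g.IsGBC) : g.conv.origin = g := by
  induction g with
  | top => rfl
  | bot => rfl
  | var x => rfl
  | neg a ih => simp [Gate.conv, Gate.origin, ih hg]
  | bin op a b iha ihb =>
    simp [Gate.conv, origin_redChain, Gate.origin, iha hg.1, ihb hg.2]
  | proj x b a ih => simp [Gate.conv, Gate.origin, ih hg]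
  | ren y x a ih => simp [Gate.conv, Gate.origin, ih hg.1]
  | red x a ih => exact hg.elim

theorem conv_mem_block (g : Gate n) : g.conv ∈ g.block := by
  cases g with
  | bin op a b =>
    exact List.mem_map.2 ⟨_, List.mem_tails _ _ |>.2 List.suffix_rfl, rfl⟩
  | _ => simp [Gate.block]

theorem origin_of_mem_block {g e : Gate n} (hg : g.IsGBC) (he : e ∈ g.block) : e.origin = g := by
  cases g with
  | bin op a b =>
    obtain ⟨t, -, rfl⟩ := List.mem_map.1 he
    rw [origin_redChain]
    simp [Gate.origin, origin_conv hg.1, origin_conv hg.2]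
  | _ =>
    simp only [Gate.block, List.mem_singleton] at he
    rw [he, origin_conv hg]

/-- The successors of a gate in a block stem from the same gate or from its successors. -/
theorem origin_child_of_mem_block {g e c : Gate n} (hg : g.IsGBC) (he : e ∈ g.block)
    (hc : c ∈ e.children) : c.origin = g ∨ c.origin ∈ g.children := by
  cases g with
  | bin op a b =>
    obtain ⟨t, ht, rfl⟩ := List.mem_map.1 he
    cases t with
    | nil =>
      simp only [Gate.redChain, List.foldr_nil, Gate.children, List.mem_cons, List.not_mem_nil,
        or_false] at hc
      rcases hc with rfl | rfl
      · simp [origin_conv hg.1, Gate.children]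
      · simp [origin_conv hg.2, Gate.children]
    | cons x t =>
      simp only [Gate.redChain, List.foldr_cons, Gate.children, List.mem_singleton] at hc
      left
      rw [hc]
      exact origin_of_mem_block hg (e := Gate.redChain t _)
        (List.mem_map.2 ⟨t, (List.mem_tails _ _).2
          ((List.suffix_cons x t).trans ((List.mem_tails _ _).1 ht)), rfl⟩)
  | red x a => exact hg.elim
  | neg a =>
    simp only [Gate.block, List.mem_singleton] at he
    subst he
    simp only [Gate.conv, Gate.children, List.mem_singleton] at hc
    simp [hc, Gate.children, origin_conv (show a.IsGBC from hg)]
  | proj x b a =>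
    simp only [Gate.block, List.mem_singleton] at he
    subst he
    simp only [Gate.conv, Gate.children, List.mem_singleton] at hc
    simp [hc, Gate.children, origin_conv (show a.IsGBC from hg)]
  | ren y x a =>
    simp only [Gate.block, List.mem_singleton] at he
    subst he
    simp only [Gate.conv, Gate.children, List.mem_singleton] at hc
    simp [hc, Gate.children, origin_conv hg.1]
  | _ =>
    simp only [Gate.block, List.mem_singleton] at he
    subst he
    simp [Gate.conv, Gate.children] at hc

theorem sizeOf_lt_of_mem_children {a c : Gate n} (h : c ∈ a.children) : sizeOf c < sizeOf a := by
  cases a <;> simp [Gate.children] at h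
  case bin => rcases h with rfl | rfl <;> simp +arith
  all_goals subst h; simp; try omega

theorem pairwise_redChain_tails (c : Gate n) (xs : List (Fin n)) :
    (xs.tails.map (fun t => Gate.redChain t c)).Pairwise (fun a b => sizeOf b < sizeOf a) := by
  induction xs with
  | nil => simp
  | cons x xs ih =>
    have hle : ∀ t ∈ xs.tails, sizeOf (Gate.redChain t c) ≤ sizeOf (Gate.redChain xs c) := by
      clear ih
      induction xs with
      | nil => simp
      | cons y ys ih =>
        intro t ht
        rw [List.tails_cons, List.mem_cons] at ht
        rcases ht with rfl | ht
        · exact le_rfl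
        · exact (ih t ht).trans (sizeOf_lt_of_mem_children (a := Gate.redChain (y :: ys) c)
            (List.mem_singleton.2 rfl)).le
    rw [List.tails_cons, List.map_cons, List.pairwise_cons]
    refine ⟨fun e he => ?_, ih⟩
    obtain ⟨t, ht, rfl⟩ := List.mem_map.1 he
    exact (hle t ht).trans_lt (sizeOf_lt_of_mem_children (a := Gate.redChain (x :: xs) c)
      (List.mem_singleton.2 rfl))

theorem pairwise_block (g : Gate n) : g.block.Pairwise (fun a b => a ∉ b.children) := by
  cases g with
  | bin op a b =>
    exact (pairwise_redChain_tails _ _).imp fun h h' =>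
      absurd (sizeOf_lt_of_mem_children h') (by omega)
  | _ => simp [Gate.block]

theorem isGBC_of_isTopo {done gs : List (Gate n)} (h : IsTopo done gs) {g : Gate n} (hg : g ∈ gs) :
    g.IsGBC := by
  induction gs with
  | nil => simp at hg
  | cons a gs ih =>
    rcases List.mem_cons.1 hg with rfl | hg
    · exact h.1
    · exact ih h.2.2.2.2 hg

theorem mem_of_isTopo {done gs : List (Gate n)} (h : IsTopo done gs) {g c : Gate n} (hg : g ∈ gs)
    (hc : c ∈ g.children) : c ∈ done ++ gs := by
  induction gs with
  | nil => simp at hg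
  | cons a gs ih =>
    rcases List.mem_cons.1 hg with rfl | hg
    · have := h.2.2.2.1 c hc
      simp only [List.mem_append, List.mem_cons]
      tauto
    · have := ih h.2.2.2.2 hg
      simp only [List.mem_append, List.mem_cons] at this ⊢
      tauto

/-- The gates of the converted circuit are visited in topological order. -/
theorem pairwise_flatMap_block {done gs : List (Gate n)} (h : IsTopo done gs) :
    (gs.flatMap Gate.block).Pairwise (fun a b => a ∉ b.children) := by
  rw [List.pairwise_flatMap]
  refine ⟨fun g _ => pairwise_block g, ?_⟩
  induction gs with
  | nil => exact List.Pairwise.nil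
  | cons g gs ih =>
    obtain ⟨hg, hdone, hgs, -, ht⟩ := h
    refine List.pairwise_cons.2 ⟨fun g' hg' e he e' he' hc => ?_, ih ht⟩
    rcases origin_child_of_mem_block (isGBC_of_isTopo ht hg') he' hc with h | h <;>
      rw [origin_of_mem_block hg he] at h
    · exact hgs (h ▸ hg')
    · rcases List.mem_append.1 (mem_of_isTopo ht hg' h) with h | h
      · exact hdone h
      · exact hgs h

end Blocks

/-! ### Certification -/

section Certify

theorem mem_claimsAbout {n : ℕ} {F : Type} {C : List (EvalClaim n F)} {a : Gate n}
    {e : EvalClaim n F} : e ∈ claimsAbout C a ↔ e ∈ C ∧ e.gate = a := by simp [claimsAbout]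

variable {n : ℕ} {F : Type} [Field F] [DecidableEq F]

theorem propagate_gate {P : OracleProver n F} {ρ σ : Fin n → F} {k : F} {a : Gate n}
    {C : List (EvalClaim n F)} (h : propagate P ρ σ k a = some C) :
    ∀ e ∈ C, e.gate ∈ a.children := by
  cases a with
  | red x a =>
    simp only [propagate, Option.bind_eq_bind, Option.bind_eq_some_iff, Option.ite_none_right_eq_some,
      Option.some.injEq] at h
    obtain ⟨q, -, -, rfl⟩ := h
    simp [Gate.children]
  | proj x b a =>
    simp only [propagate, Option.some.injEq] at h
    subst h; simp [Gate.children]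
  | ren y x a =>
    simp only [propagate, Option.some.injEq] at h
    subst h; simp [Gate.children]
  | _ =>
    simp only [propagate, Option.ite_none_right_eq_some, Option.some.injEq] at h
    obtain ⟨-, rfl⟩ := h
    simp [Gate.children]

/-- In a certification that follows the topological order, each gate is visited after all claims
about it have been collected. -/
theorem certify_eq_some {P : OracleProver n F} {ρ : Fin n → F} {L : List (Gate n)}
    {C D : List (EvalClaim n F)} (h : certify P ρ L C = some D)
    (hL : L.Pairwise (fun a b => a ∉ b.children)) :
    (∃ R, D = C ++ R ∧ ∀ e ∈ R, ∃ b ∈ L, e.gate ∈ b.children) ∧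
      ∀ a ∈ L, ∃ c C', merge P ρ a (claimsAbout D a) = some c ∧
        propagate P ρ c.σ c.k a = some C' ∧ ∀ e ∈ C', e ∈ D := by
  induction L generalizing C with
  | nil =>
    simp only [certify, Option.some.injEq] at h
    exact ⟨⟨[], by simp [h], by simp⟩, by simp⟩
  | cons a as ih =>
    simp only [certify, Option.bind_eq_bind, Option.bind_eq_some_iff] at h
    obtain ⟨c, hc, C', hC', h⟩ := h
    rw [List.pairwise_cons] at hL
    obtain ⟨⟨R, rfl, hR⟩, ih⟩ := ih h hL.2
    have hself : a ∉ a.children := fun h => lt_irrefl _ (sizeOf_lt_of_mem_children h)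
    have hC'a := propagate_gate hC'
    have hcl : claimsAbout (C ++ C' ++ R) a = claimsAbout C a := by
      have h1 : claimsAbout C' a = [] := by
        rw [List.eq_nil_iff_forall_not_mem]
        intro e he
        rw [mem_claimsAbout] at he
        exact hself (he.2 ▸ hC'a e he.1)
      have h2 : claimsAbout R a = [] := by
        rw [List.eq_nil_iff_forall_not_mem]
        intro e he
        rw [mem_claimsAbout] at he
        obtain ⟨b, hb, hb'⟩ := hR e he.1
        exact hL.1 b hb (he.2 ▸ hb')
      simp only [claimsAbout, List.filter_append] at h1 h2 ⊢
      rw [h1, h2]; simp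
    refine ⟨⟨C' ++ R, by simp, fun e he => ?_⟩, fun b hb => ?_⟩
    · rcases List.mem_append.1 he with he | he
      · exact ⟨a, List.mem_cons_self, hC'a e he⟩
      · obtain ⟨b, hb, hb'⟩ := hR e he
        exact ⟨b, List.mem_cons_of_mem _ hb, hb'⟩
    · rcases List.mem_cons.1 hb with rfl | hb
      · exact ⟨c, C', by rw [hcl]; exact hc, hC', fun e he => by simp [he]⟩
      · exact ih b hb

theorem checkEps_eq_true {P : OracleProver n F} {ρ : Fin n → F} {D : List (EvalClaim n F)}
    {a : Gate n} {k : F} (h : checkEps P ρ D (a, k) = true) {e : EvalClaim n F} (he : e ∈ D)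
    (hea : e.gate = a) : ∃ c, merge P ρ a (claimsAbout D a) = some c ∧ c.k = k := by
  unfold checkEps at h
  have hne : (claimsAbout D a).isEmpty = false := by
    rw [List.isEmpty_eq_false_iff_exists_mem]
    exact ⟨e, mem_claimsAbout.2 ⟨he, hea⟩⟩
  simp only [hne, Bool.false_eq_true, if_false] at h
  split at h
  · simp at h
  · rename_i c hc
    exact ⟨c, hc, (of_decide_eq_true h).2⟩

/-- The `ε`-nodes for the gates in the list. -/
def epsNodes (P : OracleProver n F) (ρ : Fin n → F) (gs : List (Gate n)) : List (Gate n × F) :=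
  gs.map (fun g => (g.conv, askValue P g.conv ρ))

theorem invoke_eq_some_iff {P : OracleProver n F} {ρ : Fin n → F} {E E' : List (Gate n × F)}
    {B : Batch n F} :
    invoke P ρ E B = some E' ↔ ∃ C, B.claims.mapM (normalize P ρ) = some C ∧
      ∃ D, certify P ρ (B.gates.flatMap Gate.block)
        (C.flatten ++ (epsNodes P ρ B.gates).map (fun e => ⟨e.1, ρ, e.2⟩)) = some D ∧
        (∀ e ∈ E, checkEps P ρ D e = true) ∧ E' = E ++ epsNodes P ρ B.gates := by
  simp only [invoke, Option.bind_eq_bind, Option.bind_eq_some_iff, epsNodes,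
    Option.ite_none_right_eq_some, Option.some.injEq, eq_comm (a := E')]

end Certify

/-! ### Soundness of one invocation -/

section Soundness

variable {n : ℕ}

/-- The pairs `(δ_{x_2} (δ_{x_3} … c), x_1)`, `(δ_{x_3} … c, x_2)`, …: the queries by which the
claims about the degree reductions above `c` are propagated. -/
def redQueries (c : Gate n) : List (Fin n) → List (Gate n × Fin n)
  | [] => []
  | x :: xs => (Gate.redChain xs c, x) :: redQueries c xs

/-- The queries in the block of `g` that must not be lucky: at most `n` for the merge at the top of
the block, and at most `n` for its degree reductions. -/
def blockQueries (g : Gate n) : List (Gate n × Fin n) :=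
  g.conv.freeList.map (fun x => (g.conv, x)) ++
    match g with
    | .bin op a b => redQueries (.bin op a.conv b.conv) (Gate.bin op a b).freeList
    | _ => []

variable {F : Type} [Field F]

/-- No challenge in the block of `g` is lucky, when the random assignment is `ρ`. -/
def BlockUnlucky (P : OracleProver n F) (ρ : Fin n → F) (g : Gate n) : Prop :=
  ∀ e ∈ blockQueries g, ¬ Lucky P e.1 e.2 ρ (ρ e.2)

theorem BlockUnlucky.not_lucky_conv {P : OracleProver n F} {ρ : Fin n → F} {g : Gate n}
    (h : BlockUnlucky P ρ g) {x : Fin n} (hx : x ∈ g.conv.free) :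
    ¬ Lucky P g.conv x ρ (ρ x) :=
  h (g.conv, x) (List.mem_append_left _ (List.mem_map.2 ⟨x, mem_freeList.2 hx, rfl⟩))

/-- The oracle's value of `g` at `ρ` is correct. -/
def ValueCorrect (P : OracleProver n F) (ρ : Fin n → F) (g : Gate n) : Prop :=
  askValue P g.conv ρ = val g.conv ρ

variable [DecidableEq F]

/-- Without luck, a claim is true if the result of the merge is. -/
theorem holds_of_merge {P : OracleProver n F} {ρ : Fin n → F} {a : Gate n}
    {C : List (EvalClaim n F)} {c : EvalClaim n F} (h : merge P ρ a (claimsAbout C a) = some c)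
    (hc : val a c.σ = c.k) {e : EvalClaim n F} (he : e ∈ C) (hea : e.gate = a)
    (hu : MoveUnlucky P a ρ a.freeList e.σ) : e.Holds := by
  obtain ⟨hσ, -, hmove⟩ := moveClaim_of_merge h
  obtain ⟨d, hd, hdσ, hdk⟩ := hmove e (mem_claimsAbout.2 ⟨he, hea⟩)
  refine holds_of_moveClaim hd (by rw [hea]; exact hu) ?_
  rw [EvalClaim.Holds, moveClaim_gate hd, hea, hdk, ← hc]
  exact val_congr a fun z hz => by rw [hdσ z hz, hσ z hz]

/-- The situation at the end of an accepting invocation: `D` are all claims, the gates in `L` have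
been visited, and the claims about each gate in `S` have been merged into the oracle's value. -/
structure Certified (P : OracleProver n F) (ρ : Fin n → F) (L S : List (Gate n))
    (D : List (EvalClaim n F)) : Prop where
  visited : ∀ a ∈ L, ∃ c C', merge P ρ a (claimsAbout D a) = some c ∧
    propagate P ρ c.σ c.k a = some C' ∧ ∀ e ∈ C', e ∈ D
  merged : ∀ g ∈ S, ∀ e ∈ D, e.gate = g.conv →
    ∃ c, merge P ρ g.conv (claimsAbout D g.conv) = some c ∧ c.k = askValue P g.conv ρ

theorem Certified.holds {P : OracleProver n F} {ρ : Fin n → F} {L S : List (Gate n)}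
    {D : List (EvalClaim n F)} (h : Certified P ρ L S D) {g : Gate n} (hg : g ∈ S)
    (hv : ValueCorrect P ρ g) {e : EvalClaim n F} (he : e ∈ D) (heg : e.gate = g.conv)
    (hu : MoveUnlucky P g.conv ρ g.conv.freeList e.σ) : val g.conv e.σ = e.k := by
  obtain ⟨c, hc, hck⟩ := h.merged g hg e he heg
  have := holds_of_merge hc ?_ he heg hu
  · rwa [EvalClaim.Holds, heg] at this
  · rw [hck, hv]
    exact val_congr _ (moveClaim_of_merge hc).1

/-- Along the degree reductions above `c`, correctness spreads upwards. -/
theorem Certified.val_redChain {P : OracleProver n F} {ρ : Fin n → F} {L S : List (Gate n)}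
    {D : List (EvalClaim n F)} (h : Certified P ρ L S D) (c : Gate n) (xs : List (Fin n))
    (hL : ∀ t ∈ xs.tails, Gate.redChain t c ∈ L)
    (hxs : ∀ e ∈ redQueries c xs, ¬ Lucky P e.1 e.2 ρ (ρ e.2))
    (hc : ∀ m, merge P ρ c (claimsAbout D c) = some m → val c m.σ = m.k)
    (m : EvalClaim n F)
    (hm : merge P ρ (Gate.redChain xs c) (claimsAbout D (Gate.redChain xs c)) = some m) :
    val (Gate.redChain xs c) m.σ = m.k := by
  induction xs generalizing m with
  | nil => exact hc m hm
  | cons x xs ih =>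
    have ih := ih (fun t ht => hL t (by rw [List.tails_cons]; exact List.mem_cons_of_mem _ ht))
      fun e he => hxs e (List.mem_cons_of_mem _ he)
    obtain ⟨m', C', hm', hC', hD⟩ := h.visited (Gate.redChain (x :: xs) c) (hL _ (by simp))
    obtain rfl : m' = m := by rw [hm] at hm'; exact (Option.some.inj hm').symm
    have hσ := (moveClaim_of_merge hm).1
    obtain ⟨m2, -, hm2, -⟩ := h.visited (Gate.redChain xs c) (hL _ (by simp))
    have e1 : Gate.redChain (x :: xs) c = .red x (Gate.redChain xs c) := rfl
    rw [e1] at hC' hσ ⊢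
    have hx : ¬ Lucky P (Gate.redChain xs c) x ρ (ρ x) := hxs _ List.mem_cons_self
    generalize Gate.redChain xs c = a at *
    simp only [propagate, Option.bind_eq_bind, Option.bind_eq_some_iff,
      Option.ite_none_right_eq_some, Option.some.injEq] at hC'
    obtain ⟨q, hq, hqk, rfl⟩ := hC'
    have hσ' : ∀ z ∈ a.freeList, Function.update m'.σ x (ρ x) z = ρ z := by
      intro z hz
      by_cases hzx : z = x
      · subst hzx; simp
      · simpa [hzx] using hσ z (mem_freeList.1 hz)
    have key : val a (Function.update m'.σ x (ρ x)) = q.eval (ρ x) :=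
      holds_of_merge (e := ⟨a, Function.update m'.σ x (ρ x), q.eval (ρ x)⟩) hm2 (ih m2 hm2)
        (hD _ (List.mem_singleton.2 rfl)) rfl
        (moveUnlucky_of_eq P a _ hσ')
    have hL' : ¬ Lucky P a x m'.σ (ρ x) := fun hl =>
      hx (hl.congr fun z hz _ => hσ z hz)
    have hval := eval_eq_val_of_not_lucky hq hL' key.symm
    rw [val_red, ← hval, ← hval, hqk]

/-- Without luck, the oracle's values of all gates that have been visited are correct: this is shown
from the leaves upwards. -/
theorem Certified.valueCorrect {P : OracleProver n F} {ρ : Fin n → F} {gs S : List (Gate n)}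
    {D : List (EvalClaim n F)} (h : Certified P ρ (gs.flatMap Gate.block) S D)
    (hgs : ∀ g ∈ gs, g ∈ S ∧ g.IsGBC ∧ (∀ c ∈ g.children, c ∈ S) ∧
      ⟨g.conv, ρ, askValue P g.conv ρ⟩ ∈ D)
    (hS : ∀ g ∈ S, g ∉ gs → ValueCorrect P ρ g) (hu : ∀ g ∈ S, BlockUnlucky P ρ g)
    (g : Gate n) (hg : g ∈ S) : ValueCorrect P ρ g := by
  -- It suffices that the claim which the merge at the top of the block yields is correct.
  have top : ∀ g ∈ gs, (∀ m C', merge P ρ g.conv (claimsAbout D g.conv) = some m →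
      propagate P ρ m.σ m.k g.conv = some C' → (∀ e ∈ C', e ∈ D) → val g.conv m.σ = m.k) →
      ValueCorrect P ρ g := by
    intro g hg hval
    obtain ⟨m, C', hm, hC', hD⟩ := h.visited g.conv (List.mem_flatMap.2 ⟨g, hg, conv_mem_block g⟩)
    exact (holds_of_merge hm (hval m C' hm hC' hD) (hgs g hg).2.2.2 rfl
      (moveUnlucky_of_eq P _ _ fun _ _ => rfl)).symm
  -- Claims about a successor whose value is correct, at a point that differs from `ρ` at most in
  -- the variable `y`.
  have off : ∀ a ∈ S, ValueCorrect P ρ a → ∀ (e : EvalClaim n F) (y : Fin n), e ∈ D →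
      e.gate = a.conv → (∀ z ∈ a.conv.free, z ≠ y → e.σ z = ρ z) → val a.conv e.σ = e.k :=
    fun a ha hv e y he hea hy => h.holds ha hv he hea <|
      moveUnlucky_of_eq_off P y _ (fun z hz => mem_freeList.1 hz) hy
        fun z hz => (hu a ha).not_lucky_conv hz
  have at_ρ : ∀ a ∈ S, ValueCorrect P ρ a → ∀ e : EvalClaim n F, e ∈ D →
      e.gate = a.conv → (∀ z ∈ a.conv.free, e.σ z = ρ z) → val a.conv e.σ = e.k :=
    fun a ha hv e he hea hy => h.holds ha hv he hea <|
      moveUnlucky_of_eq P _ _ fun z hz => hy z (mem_freeList.1 hz)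
  induction g with
  | top =>
    by_cases hgs' : Gate.top ∈ gs
    · refine top _ hgs' fun m C' _ hC' _ => ?_
      simp only [Gate.conv, propagate, Option.ite_none_right_eq_some] at hC'
      rw [Gate.conv, val_top, hC'.1]
    · exact hS _ hg hgs'
  | bot =>
    by_cases hgs' : Gate.bot ∈ gs
    · refine top _ hgs' fun m C' _ hC' _ => ?_
      simp only [Gate.conv, propagate, Option.ite_none_right_eq_some] at hC'
      rw [Gate.conv, val_bot, hC'.1]
    · exact hS _ hg hgs'
  | var x =>
    by_cases hgs' : Gate.var x ∈ gs
    · refine top _ hgs' fun m C' _ hC' _ => ?_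
      simp only [Gate.conv, propagate, Option.ite_none_right_eq_some] at hC'
      rw [Gate.conv, val_var, hC'.1]
    · exact hS _ hg hgs'
  | neg a ih =>
    by_cases hgs' : a.neg ∈ gs
    · have ha : a ∈ S := (hgs _ hgs').2.2.1 a (List.mem_singleton.2 rfl)
      refine top _ hgs' fun m C' hm hC' hD => ?_
      have hσ := (moveClaim_of_merge hm).1
      simp only [Gate.conv, propagate, Option.ite_none_right_eq_some, Option.some.injEq] at hC'
      obtain ⟨hk, rfl⟩ := hC'
      have := at_ρ a ha (ih ha) _ (hD _ (List.mem_singleton.2 rfl)) rfl hσ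
      simp only at this
      rw [Gate.conv, val_neg, this, hk]
    · exact hS _ hg hgs'
  | bin op a b iha ihb =>
    by_cases hgs' : Gate.bin op a b ∈ gs
    · have ha : a ∈ S := (hgs _ hgs').2.2.1 a (by simp [Gate.children])
      have hb : b ∈ S := (hgs _ hgs').2.2.1 b (by simp [Gate.children])
      have hmem : ∀ t ∈ (Gate.bin op a b).freeList.tails,
          Gate.redChain t (.bin op a.conv b.conv) ∈ gs.flatMap Gate.block := fun t ht =>
        List.mem_flatMap.2 ⟨_, hgs', List.mem_map.2 ⟨t, ht, rfl⟩⟩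
      refine top _ hgs' fun m _ hm _ _ => h.val_redChain _ _ hmem
        (fun e he => hu _ hg e (List.mem_append_right _ he)) (fun m hm => ?_) m hm
      have hσ := (moveClaim_of_merge hm).1
      obtain ⟨m', C', hm', hC', hD⟩ := h.visited _ (hmem [] (by simp))
      obtain rfl : m = m' := Option.some.inj (hm.symm.trans hm')
      simp only [Gate.redChain, List.foldr_nil, propagate, Option.ite_none_right_eq_some,
        Option.some.injEq] at hC'
      obtain ⟨hk, rfl⟩ := hC'
      have h1 := at_ρ a ha (iha ha) _ (hD _ List.mem_cons_self) rfl
        fun z hz => hσ z (Finset.mem_union_left _ hz)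
      have h2 := at_ρ b hb (ihb hb) _ (hD _ (List.mem_cons_of_mem _ List.mem_cons_self)) rfl
        fun z hz => hσ z (Finset.mem_union_right _ hz)
      simp only at h1 h2
      rw [val_bin, h1, h2, hk]
    · exact hS _ hg hgs'
  | proj x b a ih =>
    by_cases hgs' : Gate.proj x b a ∈ gs
    · have ha : a ∈ S := (hgs _ hgs').2.2.1 a (List.mem_singleton.2 rfl)
      refine top _ hgs' fun m C' hm hC' hD => ?_
      have hσ := (moveClaim_of_merge hm).1
      simp only [Gate.conv, propagate, Option.some.injEq] at hC'
      subst hC'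
      have := off a ha (ih ha) _ x (hD _ (List.mem_singleton.2 rfl)) rfl fun z hz hzx => by
        simpa [hzx] using hσ z (Finset.mem_erase.2 ⟨hzx, hz⟩)
      simp only at this
      rw [Gate.conv, val_proj, this]
    · exact hS _ hg hgs'
  | ren y x a ih =>
    by_cases hgs' : Gate.ren y x a ∈ gs
    · have ha : a ∈ S := (hgs _ hgs').2.2.1 a (List.mem_singleton.2 rfl)
      refine top _ hgs' fun m C' hm hC' hD => ?_
      have hσ := (moveClaim_of_merge hm).1
      simp only [Gate.conv, propagate, Option.some.injEq] at hC'
      subst hC'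
      have := off a ha (ih ha) _ x (hD _ (List.mem_singleton.2 rfl)) rfl fun z hz hzx => by
        simpa [hzx] using hσ z (Finset.mem_image.2 ⟨z, hz, by simp [hzx]⟩)
      simp only at this
      rw [Gate.conv, val_ren, this]
    · exact hS _ hg hgs'
  | red x a ih =>
    by_cases hgs' : Gate.red x a ∈ gs
    · exact (hgs _ hgs').2.1.elim
    · exact hS _ hg hgs'

/-- The claims that `normalize` returns are true as far as they can be moved to `ρ` without luck. -/
def NormalizedHold (P : OracleProver n F) (ρ : Fin n → F) (c : Claim n F) : Prop :=
  ∃ es, normalize P ρ c = some es ∧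
    ∀ e ∈ es, MoveUnlucky P e.gate ρ e.gate.freeList e.σ → e.Holds

theorem exists_gate_of_normalize {P : OracleProver n F} {ρ : Fin n → F} {c : Claim n F}
    {gs : List (Gate n)} {q : ℕ} (hc : c.IsAbout gs q) {es : List (EvalClaim n F)}
    (h : normalize P ρ c = some es) : ∀ e ∈ es, ∃ g ∈ gs, e.gate = g.conv := by
  cases c with
  | evalF g σ k => 
    simp only [normalize, Option.some.injEq] at h
    subst h
    simpa using ⟨g, hc, rfl⟩
  | evalB g τ b =>
    simp only [normalize, Option.some.injEq] at h
    subst h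
    simpa using ⟨g, hc, rfl⟩
  | count g k =>
    simp only [normalize, Option.some.injEq] at h
    subst h
    simpa using ⟨g, hc.1, rfl⟩
  | equiv g g' =>
    simp only [normalize, Option.ite_none_right_eq_some, Option.some.injEq] at h
    obtain ⟨-, rfl⟩ := h
    simpa using ⟨⟨g, hc.1, rfl⟩, ⟨g', hc.2, rfl⟩⟩
  | nequiv g g' =>
    simp only [normalize, Option.ite_none_left_eq_some, Option.some.injEq] at h
    obtain ⟨-, rfl⟩ := h
    simpa using ⟨⟨g, hc.1, rfl⟩, ⟨g', hc.2, rfl⟩⟩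

theorem invoke_sound {P : OracleProver n F} {ρ : Fin n → F} {done : List (Gate n)}
    {B : Batch n F} {q : ℕ} {E : List (Gate n × F)} (ht : IsTopo done B.gates)
    (hB : ∀ c ∈ B.claims, c.IsAbout (done ++ B.gates) q)
    (h : invoke P ρ (epsNodes P ρ done) B = some E)
    (hdone : ∀ g ∈ done, ValueCorrect P ρ g) (hu : ∀ g ∈ done ++ B.gates, BlockUnlucky P ρ g) :
    E = epsNodes P ρ (done ++ B.gates) ∧ (∀ g ∈ B.gates, ValueCorrect P ρ g) ∧
      ∀ c ∈ B.claims, NormalizedHold P ρ c := by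
  obtain ⟨C, hC, D, hD, heps, rfl⟩ := invoke_eq_some_iff.1 h
  obtain ⟨⟨R, hR, -⟩, hvis⟩ := certify_eq_some hD (pairwise_flatMap_block ht)
  have hclaim : ∀ g ∈ B.gates, (⟨g.conv, ρ, askValue P g.conv ρ⟩ : EvalClaim n F) ∈ D := by
    intro g hg
    rw [hR]
    refine List.mem_append_left _ (List.mem_append_right _ ?_)
    exact List.mem_map.2 ⟨_, List.mem_map.2 ⟨g, hg, rfl⟩, rfl⟩
  have hcert : Certified P ρ (B.gates.flatMap Gate.block) (done ++ B.gates) D := by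
    refine ⟨hvis, fun g hg e he heg => ?_⟩
    rcases List.mem_append.1 hg with hg | hg
    · exact checkEps_eq_true (heps _ (List.mem_map.2 ⟨g, hg, rfl⟩)) he heg
    · obtain ⟨c, -, hc, -⟩ := hvis g.conv (List.mem_flatMap.2 ⟨g, hg, conv_mem_block g⟩)
      refine ⟨c, hc, ?_⟩
      obtain ⟨-, -, hmove⟩ := moveClaim_of_merge hc
      obtain ⟨d, hd, -, hdk⟩ := hmove _ (mem_claimsAbout.2 ⟨hclaim g hg, rfl⟩)
      rw [← hdk, moveClaim_k_of_eq hd fun _ _ => rfl]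
  have hval : ∀ g ∈ done ++ B.gates, ValueCorrect P ρ g := by
    intro g hg
    refine hcert.valueCorrect (fun g hg => ⟨List.mem_append_right _ hg, isGBC_of_isTopo ht hg,
      fun c hc => mem_of_isTopo ht hg hc, hclaim g hg⟩) (fun g hg hgs => ?_) hu g hg
    exact hdone g ((List.mem_append.1 hg).resolve_right hgs)
  refine ⟨by simp [epsNodes], fun g hg => hval g (List.mem_append_right _ hg), fun c hc => ?_⟩
  obtain ⟨es, hes, hces⟩ := exists_of_mapM_eq_some hC hc
  refine ⟨es, hces, fun e he hue => ?_⟩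
  obtain ⟨g, hg, heg⟩ := exists_gate_of_normalize (hB c hc) hces e he
  have heD : e ∈ D := by
    rw [hR]
    exact List.mem_append_left _ (List.mem_append_left _ (List.mem_flatten.2 ⟨es, hes, he⟩))
  rw [EvalClaim.Holds, heg]
  rw [heg] at hue
  exact hcert.holds hg (hval g hg) heD heg hue

/-! ### Soundness of a run -/

/-- The gates of the circuit. -/
def runGates {F : Type} (run : List (Batch n F)) : List (Gate n) := run.flatMap Batch.gates

theorem run_sound {P : OracleProver n F} {ρ : Fin n → F} {q : ℕ} {done : List (Gate n)}
    {run : List (Batch n F)} {E : List (Gate n × F)} (hrun : IsRun q done run)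
    (h : run.foldlM (invoke P ρ) (epsNodes P ρ done) = some E)
    (hdone : ∀ g ∈ done, ValueCorrect P ρ g)
    (hu : ∀ g ∈ done ++ runGates run, BlockUnlucky P ρ g) :
    ∀ B ∈ run, ∀ c ∈ B.claims, NormalizedHold P ρ c := by
  induction run generalizing done with
  | nil => simp
  | cons B run ih =>
    obtain ⟨ht, hB, hrun⟩ := hrun
    simp only [List.foldlM_cons, Option.bind_eq_bind, Option.bind_eq_some_iff] at h
    obtain ⟨E', hE', h⟩ := h
    have hu' : ∀ g ∈ (done ++ B.gates) ++ runGates run, BlockUnlucky P ρ g := fun g hg =>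
      hu g (by simpa [runGates] using hg)
    obtain ⟨rfl, hval, hcl⟩ := invoke_sound ht hB hE' hdone
      fun g hg => hu' g (List.mem_append_left _ hg)
    intro B' hB'
    rcases List.mem_cons.1 hB' with rfl | hB'
    · exact hcl
    · refine ih hrun h (fun g hg => ?_) hu' B' hB'
      exact (List.mem_append.1 hg).elim (hdone g) (hval g)

end Soundness

/-! ### The number of queries -/

section SoundnessProbability

variable {n : ℕ}

theorem length_redQueries (c : Gate n) (xs : List (Fin n)) : (redQueries c xs).length = xs.length := by
  induction xs with
  | nil => rfl
  | cons x xs ih => simp [redQueries, ih]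

theorem length_blockQueries_le (g : Gate n) : (blockQueries g).length ≤ 2 * n := by
  have h1 := length_freeList_le g.conv
  have h2 := length_freeList_le g
  cases g <;> simp only [blockQueries, List.length_append, List.length_map, length_redQueries,
    List.length_nil] at * <;> omega

theorem length_blockQueries_le_of_leaf {g : Gate n} (hg : g.children = []) :
    (blockQueries g).length ≤ n := by
  have h1 := length_freeList_le g.conv
  cases g <;> simp [blockQueries, Gate.children] at * <;> exact h1

/-- Leaves have no degree reductions; this makes up for the challenges that are needed to move an
initial claim to `ρ`. -/
theorem length_flatMap_blockQueries_le {gs : List (Gate n)} (h : ∃ g ∈ gs, g.children = []) :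
    (gs.flatMap blockQueries).length + n ≤ 2 * n * gs.length := by
  have h0 : ∀ l : List (Gate n), (l.flatMap blockQueries).length ≤ 2 * n * l.length := by
    intro l
    induction l with
    | nil => simp
    | cons g l ih =>
      have := length_blockQueries_le g
      rw [List.flatMap_cons, List.length_append, List.length_cons, Nat.mul_succ]
      omega
  obtain ⟨g, hg, hleaf⟩ := h
  obtain ⟨l1, l2, rfl⟩ := List.append_of_mem hg
  have h1 := h0 l1
  have h2 := h0 l2
  have h3 := length_blockQueries_le_of_leaf hleaf
  rw [List.flatMap_append, List.flatMap_cons]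
  simp only [List.length_append, List.length_cons, Nat.mul_add, Nat.mul_succ]
  omega

theorem degreeOf_redQueries_le {F : Type} [Field F] {op : Bool → Bool → Bool} {a b : Gate n}
    (ha : a.IsGBC) (hb : b.IsGBC) (xs : List (Fin n)) :
    ∀ e ∈ redQueries (.bin op a.conv b.conv) xs, (arith F e.1).degreeOf e.2 ≤ 2 := by
  induction xs with
  | nil => simp [redQueries]
  | cons x xs ih =>
    intro e he
    rcases List.mem_cons.1 he with rfl | he
    · exact degreeOf_redChain_bin_le_two ha hb xs x
    · exact ih e he

theorem degreeOf_blockQueries_le {F : Type} [Field F] {g : Gate n} (hg : g.IsGBC) :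
    ∀ e ∈ blockQueries g, (arith F e.1).degreeOf e.2 ≤ 2 := by
  intro e he
  rcases List.mem_append.1 he with he | he
  · obtain ⟨x, -, rfl⟩ := List.mem_map.1 he
    exact (degreeOf_conv_le_one hg x).trans one_le_two
  · cases g with
    | bin op a b => exact degreeOf_redQueries_le hg.1 hg.2 _ e he
    | _ => simp at he

/-! ### The circuit of a run -/

theorem length_runGates {F : Type} (run : List (Batch n F)) : (runGates run).length = size run := by
  simp [runGates, size, List.length_flatMap]

theorem isAbout_mono {F : Type} {gs gs' : List (Gate n)} (h : ∀ g ∈ gs, g ∈ gs') {q : ℕ}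
    {c : Claim n F} (hc : c.IsAbout gs q) : c.IsAbout gs' q := by
  cases c with
  | evalF g _ _ => exact h g hc
  | evalB g _ _ => exact h g hc
  | count g _ => exact ⟨h g hc.1, hc.2⟩
  | equiv g g' => exact ⟨h g hc.1, h g' hc.2⟩
  | nequiv g g' => exact ⟨h g hc.1, h g' hc.2⟩

theorem isAbout_runGates {F : Type} {q : ℕ} {done : List (Gate n)} {run : List (Batch n F)}
    (h : IsRun q done run) : ∀ B ∈ run, ∀ c ∈ B.claims, c.IsAbout (done ++ runGates run) q := by
  induction run generalizing done with
  | nil => simp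
  | cons B run ih =>
    obtain ⟨-, hB, h⟩ := h
    intro B' hB' c hc
    rcases List.mem_cons.1 hB' with rfl | hB'
    · refine isAbout_mono (fun g hg => ?_) (hB c hc)
      simp only [runGates, List.flatMap_cons, List.mem_append] at hg ⊢
      tauto
    · have := ih h B' hB' c hc
      simpa [runGates] using this

theorem isGBC_runGates {F : Type} {q : ℕ} {done : List (Gate n)} {run : List (Batch n F)}
    (h : IsRun q done run) : ∀ g ∈ runGates run, g.IsGBC := by
  induction run generalizing done with
  | nil => simp [runGates]
  | cons B run ih =>
    intro g hg
    rcases List.mem_append.1 (show g ∈ B.gates ++ runGates run from hg) with hg | hg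
    · exact isGBC_of_isTopo h.1 hg
    · exact ih h.2.2 g hg

theorem children_mem_runGates {F : Type} {q : ℕ} {done : List (Gate n)} {run : List (Batch n F)}
    (h : IsRun q done run) :
    ∀ g ∈ runGates run, ∀ c ∈ g.children, c ∈ done ++ runGates run := by
  induction run generalizing done with
  | nil => simp [runGates]
  | cons B run ih =>
    intro g hg c hc
    rcases List.mem_append.1 (show g ∈ B.gates ++ runGates run from hg) with hg | hg
    · have := mem_of_isTopo h.1 hg hc
      simp only [runGates, List.flatMap_cons, List.mem_append] at this ⊢
      tauto
    · simpa [runGates] using ih h.2.2 g hg c hc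

theorem exists_leaf {gs : List (Gate n)} (h : ∀ g ∈ gs, ∀ c ∈ g.children, c ∈ gs) (g : Gate n)
    (hg : g ∈ gs) : ∃ g' ∈ gs, g'.children = [] := by
  induction g with
  | neg a ih => exact ih (h _ hg a (by simp [Gate.children]))
  | bin op a b ih _ => exact ih (h _ hg a (by simp [Gate.children]))
  | proj x b a ih => exact ih (h _ hg a (by simp [Gate.children]))
  | ren y x a ih => exact ih (h _ hg a (by simp [Gate.children]))
  | red x a ih => exact ih (h _ hg a (by simp [Gate.children]))
  | _ => exact ⟨_, hg, rfl⟩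

theorem exists_mem_of_isAbout {F : Type} {gs : List (Gate n)} {q : ℕ} {c : Claim n F}
    (h : c.IsAbout gs q) : ∃ g, g ∈ gs := by
  cases c with
  | evalF g _ _ => exact ⟨g, h⟩
  | evalB g _ _ => exact ⟨g, h⟩
  | count g _ => exact ⟨g, h.1⟩
  | equiv g _ => exact ⟨g, h.1⟩
  | nequiv g _ => exact ⟨g, h.1⟩

theorem isRun_take {F : Type} {q : ℕ} {done : List (Gate n)} {run : List (Batch n F)}
    (h : IsRun q done run) (j : ℕ) : IsRun q done (run.take j) := by
  induction run generalizing done j with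
  | nil => simpa using h
  | cons B run ih =>
    cases j with
    | zero => trivial
    | succ j => exact ⟨h.1, h.2.1, ih h.2.2 j⟩

theorem isRun_of_append {F : Type} {q : ℕ} {done : List (Gate n)} {run run' : List (Batch n F)}
    (h : IsRun q done (run ++ run')) : IsRun q (done ++ runGates run) run' := by
  induction run generalizing done with
  | nil => simpa [runGates] using h
  | cons B run ih => simpa [runGates] using ih h.2.2

/-! ### The probability of accepting a false claim -/

variable {p : ℕ} [Fact p.Prime]

theorem two_ne_zero_of_lt (hp : 2 ^ n < p) (hn : n ≠ 0) : (2 : ZMod p) ≠ 0 := by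
  have h2 : 2 < p := (Nat.le_self_pow hn 2).trans_lt hp
  intro h
  have : ((2 : ℕ) : ZMod p) = 0 := by exact_mod_cast h
  rw [ZMod.natCast_eq_zero_iff] at this
  exact absurd (Nat.le_of_dvd two_pos this) (by omega)

theorem prob_not_moveUnlucky_conv_le (P : OracleProver n (ZMod p)) {g : Gate n} (hg : g.IsGBC)
    (σ : Fin n → ZMod p) :
    prob (fun ρ => ¬ MoveUnlucky P g.conv ρ g.conv.freeList σ) ≤ (2 * n : ℝ) / p := by
  refine (prob_not_moveUnlucky_le P (fun x => (degreeOf_conv_le_one hg x).trans one_le_two) _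
    (nodup_freeList _) (fun _ => σ) (fun _ _ _ _ => rfl)).trans ?_
  rw [ZMod.card]
  have h1 : (g.conv.freeList.length : ℝ) ≤ n := by exact_mod_cast length_freeList_le g.conv
  calc (g.conv.freeList.length : ℝ) * (2 / p) ≤ n * (2 / p) := by gcongr
    _ = 2 * n / p := by ring

/-- After the normalization of a false claim, some evaluation claim is false, and this one is moved
to `ρ` by luck; or else the claim is an equivalence, and `ρ` does not tell the two gates apart. -/
theorem exists_event_of_not_holds (hp : 2 ^ n < p) (P : OracleProver n (ZMod p))
    {gs : List (Gate n)} (hgs : ∀ g ∈ gs, g.IsGBC) {c : Claim n (ZMod p)} (hc : c.IsAbout gs p)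
    (hfalse : ¬ c.Holds) :
    ∃ A : (Fin n → ZMod p) → Prop, prob A ≤ (3 * n : ℝ) / p ∧ (c.IsEvalF → prob A ≤ (2 * n : ℝ) / p)
      ∧ ∀ ρ, NormalizedHold P ρ c → A ρ := by
  have h23 : (2 * n : ℝ) / p ≤ (3 * n : ℝ) / p := by gcongr; norm_num
  -- a single evaluation claim, which does not depend on `ρ`
  have single : ∀ g ∈ gs, ∀ (σ : Fin n → ZMod p) (k : ZMod p), val g.conv σ ≠ k →
      (∀ ρ, NormalizedHold P ρ c → MoveUnlucky P g.conv ρ g.conv.freeList σ → val g.conv σ = k) →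
      ∃ A : (Fin n → ZMod p) → Prop, prob A ≤ (3 * n : ℝ) / p ∧
        (c.IsEvalF → prob A ≤ (2 * n : ℝ) / p) ∧ ∀ ρ, NormalizedHold P ρ c → A ρ :=
    fun g hg σ k hne h => ⟨_, (prob_not_moveUnlucky_conv_le P (hgs g hg) σ).trans h23,
      fun _ => prob_not_moveUnlucky_conv_le P (hgs g hg) σ, fun ρ hρ hu => hne (h ρ hρ hu)⟩
  cases c with
  | evalF g σ k =>
    refine single g hc σ k hfalse fun ρ hρ hu => ?_
    obtain ⟨es, hes, hρ⟩ := hρ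
    simp only [normalize, Option.some.injEq] at hes
    subst hes
    exact hρ ⟨g.conv, σ, k⟩ (List.mem_singleton.2 rfl) hu
  | evalB g τ b =>
    refine single g hc (fun x => bit (τ x)) (bit b) ?_ fun ρ hρ hu => ?_
    · rw [val_bit]
      exact fun h => hfalse (bit_injective h)
    · obtain ⟨es, hes, hρ⟩ := hρ
      simp only [normalize, Option.some.injEq] at hes
      subst hes
      exact hρ ⟨g.conv, fun x => bit (τ x), bit b⟩ (List.mem_singleton.2 rfl) hu
  | count g k =>
    refine single g hc.1 (fun _ => 2⁻¹) (k * 2⁻¹ ^ g.conv.free.card) ?_ fun ρ hρ hu => ?_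
    · rw [val_half (degreeOf_conv_le_one (hgs g hc.1)) (two_ne_zero_of_lt hp)]
      have h2 : (2⁻¹ : ZMod p) ^ g.conv.free.card ≠ 0 := by
        rcases Nat.eq_zero_or_pos n with hn | hn
        · subst hn
          have : g.conv.free = ∅ := Finset.eq_empty_of_forall_notMem fun x => x.elim0
          simp [this]
        · exact pow_ne_zero _ (inv_ne_zero (two_ne_zero_of_lt hp hn.ne'))
      intro h
      have h := mul_right_cancel₀ h2 h
      rw [ZMod.natCast_eq_natCast_iff', Nat.mod_eq_of_lt ((satCount_le _).trans_lt hp),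
        Nat.mod_eq_of_lt hc.2] at h
      exact hfalse h
    · obtain ⟨es, hes, hρ⟩ := hρ
      simp only [normalize, Option.some.injEq] at hes
      subst hes
      exact hρ ⟨g.conv, fun _ => 2⁻¹, k * 2⁻¹ ^ g.conv.free.card⟩ (List.mem_singleton.2 rfl) hu
  | equiv g h =>
    refine ⟨fun ρ => MvPolynomial.eval ρ (arith (ZMod p) g.conv - arith (ZMod p) h.conv) = 0,
      ?_, fun h => h.elim, fun ρ hρ => ?_⟩
    · refine (prob_eval_eq_zero_le ?_ fun x => ?_).trans ?_
      · intro h0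
        apply hfalse
        funext τ
        apply bit_injective (F := ZMod p)
        rw [← val_bit, ← val_bit, val, val, sub_eq_zero.1 h0]
      · exact (MvPolynomial.degreeOf_sub_le _ _ _).trans
          (max_le (degreeOf_conv_le_one (hgs g hc.1) x) (degreeOf_conv_le_one (hgs h hc.2) x))
      · rw [ZMod.card]
        gcongr
        have : (0 : ℝ) ≤ n := Nat.cast_nonneg n
        linarith
    · obtain ⟨es, hes, hρ⟩ := hρ
      simp only [normalize, Option.ite_none_right_eq_some, Option.some.injEq] at hes
      obtain ⟨huv, rfl⟩ := hes
      have h1 : val g.conv ρ = askValue P g.conv ρ := hρ ⟨g.conv, ρ, _⟩ List.mem_cons_self (moveUnlucky_of_eq P _ _ fun _ _ => rfl)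
      have h2 : val h.conv ρ = askValue P h.conv ρ := hρ ⟨h.conv, ρ, _⟩ (List.mem_cons_of_mem _ List.mem_cons_self)
        (moveUnlucky_of_eq P _ _ fun _ _ => rfl)
      rw [map_sub, sub_eq_zero]
      exact h1.trans (huv.trans h2.symm)
  | nequiv g h =>
    have hfn : g.conv.fn = h.conv.fn := by simpa [Claim.Holds] using hfalse
    set σ := P.distinct g.conv h.conv with hσ
    have hval : val g.conv σ = val h.conv σ := val_eq_of_fn_eq (degreeOf_conv_le_one (hgs g hc.1))
      (degreeOf_conv_le_one (hgs h hc.2)) hfn σ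
    by_cases h1 : val g.conv σ = askValue P g.conv σ
    · by_cases h2 : val h.conv σ = askValue P h.conv σ
      · refine ⟨fun _ => False, ?_, fun h => h.elim, fun ρ hρ => ?_⟩
        · rw [prob_false]; positivity
        · obtain ⟨es, hes, hρ⟩ := hρ
          simp only [normalize, ← hσ, ← h1, ← h2, hval, if_true] at hes
          simp at hes
      · refine single h hc.2 σ _ h2 fun ρ hρ hu => ?_
        obtain ⟨es, hes, hρ⟩ := hρ
        simp only [normalize, Option.ite_none_left_eq_some, Option.some.injEq] at hes
        obtain ⟨-, rfl⟩ := hes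
        exact hρ ⟨h.conv, σ, _⟩ (List.mem_cons_of_mem _ List.mem_cons_self) hu
    · refine single g hc.1 σ _ h1 fun ρ hρ hu => ?_
      obtain ⟨es, hes, hρ⟩ := hρ
      simp only [normalize, Option.ite_none_left_eq_some, Option.some.injEq] at hes
      obtain ⟨-, rfl⟩ := hes
      exact hρ ⟨g.conv, σ, _⟩ List.mem_cons_self hu

/-- Soundness of a run, for an arbitrary false claim and for a false evaluation claim. -/
theorem acceptProb_le_of_not_holds (hp : 2 ^ n < p) {run : List (Batch n (ZMod p))}
    (hrun : IsRun p [] run) (P : OracleProver n (ZMod p)) {B : Batch n (ZMod p)} (hB : B ∈ run)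
    {c : Claim n (ZMod p)} (hc : c ∈ B.claims) (hfalse : ¬ c.Holds) :
    acceptProb P run ≤ (4 * n * size run + n : ℝ) / p ∧
      (c.IsEvalF → acceptProb P run ≤ (4 * n * size run : ℝ) / p) := by
  have habout : c.IsAbout (runGates run) p := isAbout_runGates hrun B hB c hc
  have hGBC := isGBC_runGates hrun
  obtain ⟨A, hA3, hA2, hA⟩ := exists_event_of_not_holds hp P hGBC habout hfalse
  set Q := (runGates run).flatMap blockQueries with hQ
  have hQlen : (Q.length : ℝ) ≤ 2 * n * size run - n := by
    obtain ⟨g, hg⟩ := exists_mem_of_isAbout habout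
    have := length_flatMap_blockQueries_le (exists_leaf
      (fun g hg c hc => by simpa using children_mem_runGates hrun g hg c hc) g hg)
    rw [length_runGates, ← hQ] at this
    have : ((Q.length + n : ℕ) : ℝ) ≤ ((2 * n * size run : ℕ) : ℝ) := by exact_mod_cast this
    push_cast at this
    linarith
  have hQprob : prob (fun ρ => ∃ e ∈ Q, Lucky P e.1 e.2 ρ (ρ e.2)) ≤ Q.length * (2 / p) := by
    refine prob_exists_mem_le Q (fun e ρ => Lucky P e.1 e.2 ρ (ρ e.2)) _ fun e he => ?_
    obtain ⟨g, hg, he⟩ := List.mem_flatMap.1 he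
    have := prob_lucky_le P (degreeOf_blockQueries_le (hGBC g hg) e he) (fun ρ => ρ)
      fun ρ t z hz => Function.update_of_ne hz _ _
    rwa [ZMod.card] at this
  have hle : acceptProb P run ≤ Q.length * (2 / p) + prob A := by
    refine le_trans ?_ (add_le_add hQprob le_rfl)
    refine le_trans ?_ (prob_or_le _ _)
    refine prob_mono (A := Accepts P run) fun ρ hacc => ?_
    by_contra hcon
    push Not at hcon
    obtain ⟨E, hE⟩ := Option.isSome_iff_exists.1 hacc
    exact hcon.2 <| hA ρ <| run_sound hrun hE (by simp)
      (fun g hg e he => hcon.1 e (List.mem_flatMap.2 ⟨g, by simpa using hg, he⟩)) B hB c hc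
  have hp0 : (0 : ℝ) < p := by exact_mod_cast (Fact.out : p.Prime).pos
  have hQ2 : (Q.length : ℝ) * (2 / p) ≤ (4 * n * size run - 2 * n) / p := by
    rw [mul_div_assoc', div_le_div_iff_of_pos_right hp0]
    linarith
  refine ⟨?_, fun h => ?_⟩
  · refine (hle.trans (add_le_add hQ2 hA3)).trans (le_of_eq ?_)
    ring
  · refine (hle.trans (add_le_add hQ2 (hA2 h))).trans (le_of_eq ?_)
    ring

end SoundnessProbability

/-! ### Completeness -/

section Completeness

variable {n : ℕ} {F : Type} [Field F]

/-- The degree in each variable is at most two, so that Verifier does not reject the true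
polynomials. -/
def LowDegree (F : Type) [Field F] (a : Gate n) : Prop := ∀ x, (arith F a).degreeOf x ≤ 2

theorem lowDegree_conv {g : Gate n} (hg : g.IsGBC) : LowDegree F g.conv :=
  fun x => (degreeOf_conv_le_one hg x).trans one_le_two

theorem getD_restrict {S : Finset (Fin n)} {σ : Fin n → F} {z : Fin n} (hz : z ∈ S) :
    (restrict S σ z).getD 0 = σ z := by simp [restrict, hz]

theorem askValue_honest (d : Gate n → Gate n → (Fin n → F)) (a : Gate n) (σ : Fin n → F) :
    askValue (honestProver d) a σ = val a σ :=
  val_congr a fun _ hz => getD_restrict hz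

theorem exists_askPoly_honest (d : Gate n → Gate n → (Fin n → F)) {a : Gate n}
    (ha : LowDegree F a) (σ : Fin n → F) (x : Fin n) :
    ∃ q, askPoly (honestProver d) a σ x = some q ∧ ∀ t, q.eval t = val a (Function.update σ x t) := by
  refine ⟨linePoly a (fun y => (restrict (a.free.erase x) σ y).getD 0) x,
    askPoly_eq_some_iff.2 ⟨rfl, (natDegree_linePoly_le _ _ _).trans (ha x)⟩, fun t => ?_⟩
  rw [eval_linePoly]
  exact val_update_congr (fun z hz hzx => getD_restrict (Finset.mem_erase.2 ⟨hzx, hz⟩)) t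

variable [DecidableEq F]

theorem exists_moveClaim_honest (d : Gate n → Gate n → (Fin n → F)) (ρ : Fin n → F)
    (xs : List (Fin n)) {c : EvalClaim n F} (hd : LowDegree F c.gate) (hc : c.Holds) :
    ∃ c', moveClaim (honestProver d) ρ xs c = some c' ∧ c'.Holds := by
  induction xs generalizing c with
  | nil => exact ⟨c, rfl, hc⟩
  | cons x xs ih =>
    obtain ⟨q, hq, hq'⟩ := exists_askPoly_honest d hd c.σ x
    obtain ⟨c', hc', hh⟩ := ih (c := ⟨c.gate, Function.update c.σ x (ρ x), q.eval (ρ x)⟩) hd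
      (hq' (ρ x)).symm
    refine ⟨c', moveClaim_cons_eq_some_iff.2 ⟨_, mergeClaim_eq_some_iff.2 ⟨q, hq, ?_, rfl⟩, hc'⟩, hh⟩
    rw [hq', Function.update_eq_self]
    exact hc

theorem exists_mapM_eq_some {α β : Type} {f : α → Option β} {Q : β → Prop} {l : List α}
    (h : ∀ a ∈ l, ∃ b, f a = some b ∧ Q b) : ∃ l', l.mapM f = some l' ∧ ∀ b ∈ l', Q b := by
  induction l with
  | nil => exact ⟨[], by simp, by simp⟩
  | cons a l ih =>
    obtain ⟨b, hb, hQ⟩ := h a List.mem_cons_self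
    obtain ⟨l', hl', hQ'⟩ := ih fun a ha => h a (List.mem_cons_of_mem _ ha)
    refine ⟨b :: l', by simp [List.mapM_cons, hb, hl'], fun b' hb' => ?_⟩
    rcases List.mem_cons.1 hb' with rfl | hb'
    · exact hQ
    · exact hQ' _ hb'

theorem exists_merge_honest (d : Gate n → Gate n → (Fin n → F)) (ρ : Fin n → F) {a : Gate n}
    (ha : LowDegree F a) {C : List (EvalClaim n F)} (hne : C ≠ [])
    (hC : ∀ e ∈ C, e.gate = a ∧ e.Holds) :
    ∃ c, merge (honestProver d) ρ a C = some c ∧ val a c.σ = c.k := by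
  obtain ⟨D, hD, hDk⟩ := exists_mapM_eq_some (f := moveClaim (honestProver d) ρ a.freeList)
    (Q := fun c => (∀ z ∈ a.free, c.σ z = ρ z) ∧ val a c.σ = c.k) (l := C) fun e he => by
      obtain ⟨hea, hh⟩ := hC e he
      obtain ⟨c', hc', hh'⟩ := exists_moveClaim_honest d ρ a.freeList (hea ▸ ha) hh
      refine ⟨c', hc', fun z hz => moveClaim_σ hc' z (Or.inl (mem_freeList.2 hz)), ?_⟩
      rw [EvalClaim.Holds, moveClaim_gate hc', hea] at hh'
      exact hh'
  rw [mapM_eq_some_iff] at hD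
  cases D with
  | nil => exact absurd (List.forall₂_nil_right_iff.1 hD) hne
  | cons c D' =>
    have hc := hDk c List.mem_cons_self
    refine ⟨c, merge_eq_some_iff.2 ⟨_, hD, D', rfl, fun e he => ?_⟩, hc.2⟩
    have he := hDk e (List.mem_cons_of_mem _ he)
    have hz : ∀ z ∈ a.free, e.σ z = c.σ z := fun z hz => by rw [he.1 z hz, hc.1 z hz]
    exact ⟨restrict_congr hz, by rw [← he.2, ← hc.2, val_congr a hz]⟩

theorem exists_propagate_honest (d : Gate n → Gate n → (Fin n → F)) (ρ σ : Fin n → F) {k : F}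
    {a : Gate n} (ha : ∀ b ∈ a.children, LowDegree F b) (hk : val a σ = k) :
    ∃ C, propagate (honestProver d) ρ σ k a = some C ∧ (∀ e ∈ C, e.Holds) ∧
      ∀ b ∈ a.children, ∃ e ∈ C, e.gate = b := by
  subst hk
  cases a with
  | top => exact ⟨[], by simp [propagate, val_top], by simp, by simp [Gate.children]⟩
  | bot => exact ⟨[], by simp [propagate, val_bot], by simp, by simp [Gate.children]⟩
  | var x => exact ⟨[], by simp [propagate, val_var], by simp, by simp [Gate.children]⟩
  | neg a =>
    refine ⟨[⟨a, σ, val a σ⟩], by simp [propagate, val_neg, askValue_honest], ?_, ?_⟩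
    · simp [EvalClaim.Holds]
    · simp [Gate.children]
  | bin op a b =>
    refine ⟨[⟨a, σ, val a σ⟩, ⟨b, σ, val b σ⟩],
      by simp [propagate, val_bin, askValue_honest], ?_, ?_⟩
    · simp [EvalClaim.Holds]
    · simp [Gate.children]
  | proj x b a =>
    refine ⟨_, rfl, ?_, by simp [Gate.children]⟩
    simp [EvalClaim.Holds, val_proj]
  | ren y x a =>
    refine ⟨_, rfl, ?_, by simp [Gate.children]⟩
    simp [EvalClaim.Holds, val_ren]
  | red x a =>
    obtain ⟨q, hq, hq'⟩ := exists_askPoly_honest d (ha a (by simp [Gate.children])) σ x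
    refine ⟨[⟨a, Function.update σ x (ρ x), q.eval (ρ x)⟩], ?_, ?_, by simp [Gate.children]⟩
    · simp [propagate, hq, hq', val_red]
    · simp [EvalClaim.Holds, hq']

theorem exists_certify_cons_honest (d : Gate n → Gate n → (Fin n → F)) (ρ : Fin n → F) {a : Gate n}
    (ha : LowDegree F a) (hch : ∀ b ∈ a.children, LowDegree F b) {C : List (EvalClaim n F)}
    (hC : ∀ e ∈ C, e.Holds) (haC : ∃ e ∈ C, e.gate = a) :
    ∃ C', (∀ as, certify (honestProver d) ρ (a :: as) C = certify (honestProver d) ρ as (C ++ C')) ∧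
      (∀ e ∈ C', e.Holds) ∧ ∀ b ∈ a.children, ∃ e ∈ C', e.gate = b := by
  obtain ⟨e, he, hea⟩ := haC
  obtain ⟨c, hc, hck⟩ := exists_merge_honest d ρ ha (C := claimsAbout C a)
    (List.ne_nil_of_mem (mem_claimsAbout.2 ⟨he, hea⟩))
    fun e he => ⟨(mem_claimsAbout.1 he).2, hC e (mem_claimsAbout.1 he).1⟩
  obtain ⟨C', hC', h1, h2⟩ := exists_propagate_honest d ρ c.σ hch hck
  exact ⟨C', fun as => by simp [certify, hc, hC'], h1, h2⟩

theorem certify_append (P : OracleProver n F) (ρ : Fin n → F) (L L' : List (Gate n))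
    (C : List (EvalClaim n F)) :
    certify P ρ (L ++ L') C = (certify P ρ L C).bind (certify P ρ L') := by
  induction L generalizing C with
  | nil => rfl
  | cons a as ih =>
    simp only [List.cons_append, certify, ih, Option.bind_eq_bind, Option.bind_assoc]

/-- The certification of `L` from `C` succeeds and keeps all claims true. -/
def CertifyHolds (P : OracleProver n F) (ρ : Fin n → F) (L : List (Gate n))
    (C : List (EvalClaim n F)) : Prop :=
  ∃ R, certify P ρ L C = some (C ++ R) ∧ ∀ e ∈ R, e.Holds

theorem certifyHolds_redChain (d : Gate n → Gate n → (Fin n → F)) (ρ : Fin n → F) {c : Gate n}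
    (hc : ∀ t, LowDegree F (Gate.redChain t c)) (hch : ∀ b ∈ c.children, LowDegree F b)
    (xs : List (Fin n)) {C : List (EvalClaim n F)} (hC : ∀ e ∈ C, e.Holds)
    (hcC : ∃ e ∈ C, e.gate = Gate.redChain xs c) :
    CertifyHolds (honestProver d) ρ (xs.tails.map (fun t => Gate.redChain t c)) C := by
  induction xs generalizing C with
  | nil =>
    obtain ⟨C', h, hC', -⟩ := exists_certify_cons_honest d ρ (hc []) hch hC hcC
    exact ⟨C', by simpa [certify] using h [], hC'⟩
  | cons x xs ih =>
    obtain ⟨C', h, hC', hch'⟩ := exists_certify_cons_honest d ρ (hc (x :: xs))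
      (fun b hb => by rw [List.mem_singleton.1 hb]; exact hc xs) hC hcC
    obtain ⟨e, he, heg⟩ := hch' (Gate.redChain xs c) (List.mem_singleton.2 rfl)
    obtain ⟨R, hR, hRh⟩ := ih (C := C ++ C')
      (fun e he => (List.mem_append.1 he).elim (hC e) (hC' e))
      ⟨e, List.mem_append_right _ he, heg⟩
    refine ⟨C' ++ R, ?_, fun e he => (List.mem_append.1 he).elim (hC' e) (hRh e)⟩
    rw [List.tails_cons, List.map_cons, h, hR, List.append_assoc]

theorem certifyHolds_block (d : Gate n → Gate n → (Fin n → F)) (ρ : Fin n → F) {g : Gate n}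
    (hg : g.IsGBC) {C : List (EvalClaim n F)} (hC : ∀ e ∈ C, e.Holds)
    (hgC : ∃ e ∈ C, e.gate = g.conv) : CertifyHolds (honestProver d) ρ g.block C := by
  have single : (∀ b ∈ g.conv.children, LowDegree F b) →
      CertifyHolds (honestProver d) ρ [g.conv] C := fun hch => by
    obtain ⟨C', h, hC', -⟩ := exists_certify_cons_honest d ρ (lowDegree_conv hg) hch hC hgC
    exact ⟨C', by simpa [certify] using h [], hC'⟩
  cases g with
  | bin op a b =>
    refine certifyHolds_redChain d ρ (fun t x => degreeOf_redChain_bin_le_two hg.1 hg.2 t x)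
      (fun e he => ?_) _ hC hgC
    simp only [Gate.children, List.mem_cons, List.not_mem_nil, or_false] at he
    rcases he with rfl | rfl
    · exact lowDegree_conv hg.1
    · exact lowDegree_conv hg.2
  | neg a =>
    refine single fun b hb => ?_
    rw [List.mem_singleton.1 hb]
    exact lowDegree_conv (show a.IsGBC from hg)
  | proj x b a =>
    refine single fun b hb => ?_
    rw [List.mem_singleton.1 hb]
    exact lowDegree_conv (show a.IsGBC from hg)
  | ren y x a =>
    refine single fun b hb => ?_
    rw [List.mem_singleton.1 hb]
    exact lowDegree_conv hg.1
  | red x a => exact hg.elim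
  | _ => exact single (by simp [Gate.conv, Gate.children])

theorem certifyHolds_flatMap_block (d : Gate n → Gate n → (Fin n → F)) (ρ : Fin n → F)
    {gs : List (Gate n)} (hgs : ∀ g ∈ gs, g.IsGBC) {C : List (EvalClaim n F)}
    (hC : ∀ e ∈ C, e.Holds) (hgC : ∀ g ∈ gs, ∃ e ∈ C, e.gate = g.conv) :
    CertifyHolds (honestProver d) ρ (gs.flatMap Gate.block) C := by
  induction gs generalizing C with
  | nil => exact ⟨[], by simp [certify], by simp⟩
  | cons g gs ih =>
    obtain ⟨R, hR, hRh⟩ := certifyHolds_block d ρ (hgs g List.mem_cons_self) hC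
      (hgC g List.mem_cons_self)
    obtain ⟨R', hR', hRh'⟩ := ih (fun g hg => hgs g (List.mem_cons_of_mem _ hg)) (C := C ++ R)
      (fun e he => (List.mem_append.1 he).elim (hC e) (hRh e)) fun g hg => by
        obtain ⟨e, he, heg⟩ := hgC g (List.mem_cons_of_mem _ hg)
        exact ⟨e, List.mem_append_left _ he, heg⟩
    refine ⟨R ++ R', ?_, fun e he => (List.mem_append.1 he).elim (hRh e) (hRh' e)⟩
    rw [List.flatMap_cons, certify_append, hR, Option.bind_some, hR', List.append_assoc]

theorem checkEps_honest (d : Gate n → Gate n → (Fin n → F)) (ρ : Fin n → F)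
    {D : List (EvalClaim n F)} (hD : ∀ e ∈ D, e.Holds) {a : Gate n} (ha : LowDegree F a) :
    checkEps (honestProver d) ρ D (a, askValue (honestProver d) a ρ) = true := by
  unfold checkEps
  by_cases hne : claimsAbout D a = []
  · simp [hne]
  · obtain ⟨c, hc, hck⟩ := exists_merge_honest d ρ ha hne
      fun e he => ⟨(mem_claimsAbout.1 he).2, hD e (mem_claimsAbout.1 he).1⟩
    have hσ := (moveClaim_of_merge hc).1
    have hk : c.k = askValue (honestProver d) a ρ := by
      rw [askValue_honest, ← hck, val_congr a hσ]
    simp [hne, hc, hk, restrict_congr hσ]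

theorem exists_normalize_honest {d : Gate n → Gate n → (Fin n → F)} (hd : IsDistinguisher d)
    (h2 : n ≠ 0 → (2 : F) ≠ 0) (ρ : Fin n → F) {gs : List (Gate n)} (hgs : ∀ g ∈ gs, g.IsGBC)
    {q : ℕ} {c : Claim n F} (hc : c.IsAbout gs q) (hh : c.Holds) :
    ∃ es, normalize (honestProver d) ρ c = some es ∧ ∀ e ∈ es, e.Holds := by
  cases c with
  | evalF g σ k =>
    refine ⟨_, rfl, ?_⟩
    simp only [List.mem_singleton, forall_eq]
    exact hh
  | evalB g τ b =>
    refine ⟨_, rfl, ?_⟩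
    have hh : g.conv.fn τ = b := hh
    simp [EvalClaim.Holds, val_bit, hh]
  | count g k =>
    refine ⟨_, rfl, ?_⟩
    have hh : g.conv.satCount = k := hh
    simp only [List.mem_singleton, forall_eq, EvalClaim.Holds]
    rw [val_half (degreeOf_conv_le_one (hgs g hc.1)) h2, hh]
  | equiv g h =>
    have hval : val g.conv ρ = val h.conv ρ := val_eq_of_fn_eq (degreeOf_conv_le_one (hgs g hc.1))
      (degreeOf_conv_le_one (hgs h hc.2)) hh ρ
    refine ⟨[⟨g.conv, ρ, val g.conv ρ⟩, ⟨h.conv, ρ, val h.conv ρ⟩], ?_, ?_⟩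
    · simp [normalize, askValue_honest, hval]
    · simp [EvalClaim.Holds]
  | nequiv g h =>
    have hex : ∃ σ : Fin n → F, val g.conv σ ≠ val h.conv σ := by
      by_contra hcon
      push Not at hcon
      refine (show g.conv.fn ≠ h.conv.fn from hh) (funext fun τ => bit_injective (F := F) ?_)
      rw [← val_bit, ← val_bit, hcon]
    have hne := hd _ _ hex
    set σ := d g.conv h.conv with hσ
    refine ⟨[⟨g.conv, σ, val g.conv σ⟩, ⟨h.conv, σ, val h.conv σ⟩], ?_, ?_⟩
    · have : (honestProver d).distinct g.conv h.conv = σ := rfl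
      simp [normalize, askValue_honest, this, hne]
    · simp [EvalClaim.Holds]

/-- With the honest Prover, an invocation whose claims are true does not reject. -/
theorem exists_invoke_honest {d : Gate n → Gate n → (Fin n → F)} (hd : IsDistinguisher d)
    (h2 : n ≠ 0 → (2 : F) ≠ 0) (ρ : Fin n → F) {done : List (Gate n)} {B : Batch n F} {q : ℕ}
    (hgs : ∀ g ∈ done ++ B.gates, g.IsGBC) (hB : ∀ c ∈ B.claims, c.IsAbout (done ++ B.gates) q)
    (hh : ∀ c ∈ B.claims, c.Holds) :
    ∃ E, invoke (honestProver d) ρ (epsNodes (honestProver d) ρ done) B = some E := by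
  obtain ⟨Cs, hCs, hCh⟩ := exists_mapM_eq_some (f := normalize (honestProver d) ρ)
    (Q := fun es => ∀ e ∈ es, e.Holds) (l := B.claims)
    fun c hc => exists_normalize_honest hd h2 ρ hgs (hB c hc) (hh c hc)
  set C := Cs.flatten ++ (epsNodes (honestProver d) ρ B.gates).map
    (fun e => (⟨e.1, ρ, e.2⟩ : EvalClaim n F)) with hC
  have hCholds : ∀ e ∈ C, e.Holds := by
    intro e he
    rcases List.mem_append.1 he with he | he
    · obtain ⟨es, hes, he⟩ := List.mem_flatten.1 he
      exact hCh es hes e he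
    · obtain ⟨e', he', rfl⟩ := List.mem_map.1 he
      obtain ⟨g, -, rfl⟩ := List.mem_map.1 he'
      simp [EvalClaim.Holds, askValue_honest]
  obtain ⟨R, hR, hRh⟩ := certifyHolds_flatMap_block d ρ
    (fun g hg => hgs g (List.mem_append_right _ hg)) hCholds fun g hg =>
      ⟨_, List.mem_append_right _ (List.mem_map.2 ⟨_, List.mem_map.2 ⟨g, hg, rfl⟩, rfl⟩), rfl⟩
  refine ⟨_, invoke_eq_some_iff.2 ⟨Cs, hCs, C ++ R, hR, fun e he => ?_, rfl⟩⟩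
  obtain ⟨g, hg, rfl⟩ := List.mem_map.1 he
  exact checkEps_honest d ρ (fun e he => (List.mem_append.1 he).elim (hCholds e) (hRh e))
    (lowDegree_conv (hgs g (List.mem_append_left _ hg)))

theorem foldlM_invoke_eq_some {P : OracleProver n F} {ρ : Fin n → F} {done : List (Gate n)}
    {run : List (Batch n F)} {E : List (Gate n × F)}
    (h : run.foldlM (invoke P ρ) (epsNodes P ρ done) = some E) :
    E = epsNodes P ρ (done ++ runGates run) := by
  induction run generalizing done with
  | nil => simpa [runGates, eq_comm] using h
  | cons B run ih =>
    simp only [List.foldlM_cons, Option.bind_eq_bind, Option.bind_eq_some_iff] at h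
    obtain ⟨E', hE', h⟩ := h
    obtain ⟨-, -, -, -, -, rfl⟩ := invoke_eq_some_iff.1 hE'
    rw [epsNodes, epsNodes, ← List.map_append] at h
    have := ih h
    simpa [runGates] using this

/-- With the honest Prover, an invocation whose claims are true is not the first one to reject. -/
theorem accepts_take_succ_iff {d : Gate n → Gate n → (Fin n → F)} (hd : IsDistinguisher d)
    (h2 : n ≠ 0 → (2 : F) ≠ 0) {q : ℕ} {run : List (Batch n F)} (hrun : IsRun q [] run) {j : ℕ}
    (hj : j < run.length) (hh : ∀ c ∈ run[j].claims, c.Holds) (ρ : Fin n → F) :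
    Accepts (honestProver d) (run.take (j + 1)) ρ ↔ Accepts (honestProver d) (run.take j) ρ := by
  rw [Accepts, Accepts, List.take_add_one, List.getElem?_eq_getElem hj, Option.toList_some,
    List.foldlM_append]
  cases hE : (run.take j).foldlM (invoke (honestProver d) ρ) [] with
  | none => simp
  | some E =>
    have hE' := foldlM_invoke_eq_some (done := []) hE
    subst hE'
    have hsplit : run = run.take j ++ run[j] :: run.drop (j + 1) := by simp
    have hrun' : IsRun q ([] ++ runGates (run.take j)) (run[j] :: run.drop (j + 1)) := by
      apply isRun_of_append
      rwa [← hsplit]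
    have hGBC : ∀ g ∈ ([] ++ runGates (run.take j)) ++ run[j].gates, g.IsGBC := by
      intro g hg
      rcases List.mem_append.1 hg with hg | hg
      · exact isGBC_runGates (isRun_take hrun j) g (by simpa using hg)
      · exact isGBC_of_isTopo hrun'.1 hg
    obtain ⟨E', hE'⟩ := exists_invoke_honest hd h2 ρ hGBC hrun'.2.1 hh
    rw [List.nil_append] at hE'
    simp [hE']

end Completeness

end GBCCert

theorem mainTheorem3 (n p : ℕ) [Fact p.Prime] (hp : 2 ^ n < p)
    (run : List (GBCCert.Batch n (ZMod p))) (hrun : GBCCert.IsRun p [] run) :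
    -- soundness: some claim is false
    ((∃ B ∈ run, ∃ c ∈ B.claims, ¬ c.Holds) →
      ∀ P : GBCCert.OracleProver n (ZMod p),
        GBCCert.acceptProb P run ≤ (4 * n * GBCCert.size run + n : ℝ) / p) ∧
    -- soundness of the first `j + 1` invocations
    (∀ (j : ℕ) (hj : j < run.length) (P : GBCCert.OracleProver n (ZMod p)),
      ((∃ c ∈ run[j].claims, c.IsEvalF ∧ ¬ c.Holds) →
        GBCCert.acceptProb P (run.take (j + 1))
          ≤ (4 * n * GBCCert.size (run.take (j + 1)) : ℝ) / p) ∧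
      ((∃ c ∈ run[j].claims, ¬ c.Holds) →
        GBCCert.acceptProb P (run.take (j + 1))
          ≤ (4 * n * GBCCert.size (run.take (j + 1)) + n : ℝ) / p)) ∧
    -- completeness: all claims are true
    ((∀ B ∈ run, ∀ c ∈ B.claims, c.Holds) →
      ∀ d : GBCCert.Gate n → GBCCert.Gate n → (Fin n → ZMod p), GBCCert.IsDistinguisher d →
        GBCCert.acceptProb (GBCCert.honestProver d) run = 1) ∧
    -- completeness of a single invocation: it never is the first one to reject
    (∀ (j : ℕ) (hj : j < run.length), (∀ c ∈ run[j].claims, c.Holds) →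
      ∀ d : GBCCert.Gate n → GBCCert.Gate n → (Fin n → ZMod p), GBCCert.IsDistinguisher d →
        GBCCert.acceptProb (GBCCert.honestProver d) (run.take (j + 1))
          = GBCCert.acceptProb (GBCCert.honestProver d) (run.take j)) := by
  have hmem : ∀ (j : ℕ) (hj : j < run.length), run[j] ∈ run.take (j + 1) := fun j hj =>
    List.mem_take_iff_getElem.2 ⟨j, by omega, rfl⟩
  have h2 : n ≠ 0 → (2 : ZMod p) ≠ 0 := GBCCert.two_ne_zero_of_lt hp
  refine ⟨?_, fun j hj P => ⟨?_, ?_⟩, fun h d hd => ?_, fun j hj h d hd => ?_⟩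
  · rintro ⟨B, hB, c, hc, hf⟩ P
    exact (GBCCert.acceptProb_le_of_not_holds hp hrun P hB hc hf).1
  · rintro ⟨c, hc, hE, hf⟩
    exact (GBCCert.acceptProb_le_of_not_holds hp (GBCCert.isRun_take hrun _) P (hmem j hj) hc hf).2
      hE
  · rintro ⟨c, hc, hf⟩
    exact (GBCCert.acceptProb_le_of_not_holds hp (GBCCert.isRun_take hrun _) P (hmem j hj) hc hf).1
  · have hacc : ∀ j ≤ run.length, ∀ ρ,
        GBCCert.Accepts (GBCCert.honestProver d) (run.take j) ρ := by
      intro j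
      induction j with
      | zero => intro _ ρ; simp [GBCCert.Accepts]
      | succ j ih =>
        intro hj ρ
        rw [GBCCert.accepts_take_succ_iff hd h2 hrun hj (h _ (List.getElem_mem hj))]
        exact ih (by omega) ρ
    have hall : GBCCert.Accepts (GBCCert.honestProver d) run = fun _ => True := by
      funext ρ
      simpa using hacc run.length le_rfl ρ
    have : GBCCert.acceptProb (GBCCert.honestProver d) run
        = GBCCert.prob (GBCCert.Accepts (GBCCert.honestProver d) run) := rfl
    rw [this, hall, GBCCert.prob_true]
  · have : GBCCert.Accepts (GBCCert.honestProver d) (run.take (j + 1))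
        = GBCCert.Accepts (GBCCert.honestProver d) (run.take j) :=
      funext fun ρ => propext (GBCCert.accepts_take_succ_iff hd h2 hrun hj h ρ)
    rw [GBCCert.acceptProb, GBCCert.acceptProb, this]
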